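/- Exact marginals for low-rank distinguishability. Let $n$ photons enter the first $n$ modes ($n\le m$) of a linear interferometer with $m\times m$ unitary matrix $U$, where $U_{lj}$ is the amplitude from input mode $j$ to output mode $l$. The photon in mode $j$ has a pure internal state $\phi_j$, a unit vector in a complex Hilbert space of any dimension. The input state is thus $\prod_{j=1}^n a^\dagger_{j,\phi_j}|0\rangle$ in the bosonic Fock space, and $U$ acts on the spatial modes only. Let $S_{ij}=\langle\phi_i,\phi_j\rangle$ be the Gram matrix and $r_S=\operatorname{rank} S$. Fix $K$ distinct output modes $M_1,\dots,M_K$. Let $P(\mathbf k)$, $\mathbf k\in\{0,\dots,n\}^K$, be the probability of finding $k_z$ photons (whatever their internal states) in mode $M_z$ for every $z$, and let $$x(\eta)=\sum_{\mathbf k\in\{0,\dots,n\}^K}P(\mathbf k)\,e^{i\eta\cdot\mathbf k},\qquad \eta\in\mathbb R^K,$$ be the generating function of this marginal. Let $\Lambda(\eta)$ be the $m\times m$ diagonal matrix with entry $e^{i\eta_z}$ at mode $M_z$ and $1$ at all other modes, and let $W(\eta)$ be the upper left $n\times n$ block of $U^\dagger(\Lambda(\eta)-\mathbb 1_m)U$.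 Write $\odot$ for the entrywise product. Running times count steps of a random access machine that performs each exact arithmetic operation $+,-,\times,/$, complex conjugation and equality test on complex numbers, and each addition, subtraction and comparison of natural numbers, at unit cost. 1. For all $\eta\in\mathbb R^K$, $$x(\eta)=\operatorname{perm}\bigl(\mathbb 1_n+W(\eta)\odot S\bigr),\qquad \operatorname{rank}\bigl(W(\eta)\odot S\bigr)\le K\,r_S .$$ 2. There is an algorithm which, given $n\ge 1$, $m$, $K$, $U$, $S$, the modes $M_1,\dots,M_K$ and the phases $e^{i\eta_1},\dots,e^{i\eta_K}$, computes $x(\eta)$ exactly in time $O(n^{2Kr_S+1})$, where the implied constant depends only on $K$ and $r_S$. 3. There is an algorithm which, given $n\ge1$, $m$, $K$, $U$, $S$ and $M_1,\dots,M_K$, computes all the probabilities $P(\mathbf k)$, $\mathbf k\in\{0,\dots,n\}^K$, exactly, in a time that for constant $K$ and $r_S$ is polynomial in $n$: it is at most $c\,n^{d}$ with $c,d$ depending only on $K$ and $r_S$. 4. If $n\ge1$ and the photons are indistinguishable ($\phi_i=\phi_j$ for all $i,j$), then $r_S=1$ and $x(\eta)=\operatorname{perm}(\mathbb 1_n+W(\eta))$;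 so 2 and 3 contain the case of indistinguishable photons. -/

import Mathlib

/-! ## Boson sampling with pure, partially distinguishable photons -/

/-- A boson sampling experiment: `n` single photons enter the first `n` modes of an `m`-mode
linear interferometer `U`; the photon in mode `j` has the internal state `φ j`, a unit vector of a
complex Hilbert space `H` of any dimension.  `Φ` is a finite orthonormal family of internal
states in which all the `φ j` can be expanded (one with at most `n` members always exists). -/
structure BosonSampler (n m : ℕ) (H : Type*) [NormedAddCommGroup H] [InnerProductSpace ℂ H] where
  n_le_m : n ≤ m
  /-- `U l j` is the single-photon amplitude from input mode `j` to output mode `l`. -/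
  U : Matrix (Fin m) (Fin m) ℂ
  unitary : U ∈ Matrix.unitaryGroup (Fin m) ℂ
  φ : Fin n → H
  norm_φ : ∀ j, ‖φ j‖ = 1
  d : ℕ
  Φ : Fin d → H
  orthonormal : Orthonormal ℂ Φ
  complete : ∀ j, ∑ α, inner ℂ (φ j) (Φ α) * inner ℂ (Φ α) (φ j) = 1

namespace BosonSampler

variable {n m K : ℕ} {H : Type*} [NormedAddCommGroup H] [InnerProductSpace ℂ H]

/-- The input mode of the `j`-th photon. -/
def inMode (E : BosonSampler n m H) (j : Fin n) : Fin m := Fin.castLE E.n_le_m j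

/-- The Gram matrix `S i j = ⟨φ i, φ j⟩` of the internal states. -/
noncomputable def S (E : BosonSampler n m H) : Matrix (Fin n) (Fin n) ℂ :=
  Matrix.gram ℂ E.φ

/-- The (algebraic) bosonic Fock space over the modes `(l, α)`, with `l` a spatial mode and `α`
the internal state `Φ α`.  The monomial `X ^ t` is the unnormalised vector obtained by applying
the creation operators with multiplicities `t` to the vacuum `1`, so creation operators act by
multiplication, `∏ (a†) ^ t |0⟩ = X ^ t`, and the normalised occupation number state is
`|t⟩ = X ^ t / √(∏ t!)`. -/
abbrev Fock (E : BosonSampler n m H) : Type := MvPolynomial (Fin m × Fin E.d) ℂ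

/-- The creation operator of a photon in spatial mode `l` and internal state `ψ`,
`∑ α, ⟨Φ α, ψ⟩ a†_(l, Φ α)`, as a multiplication operator. -/
noncomputable def creation (E : BosonSampler n m H) (l : Fin m) (ψ : H) : E.Fock :=
  ∑ α, MvPolynomial.C (inner ℂ (E.Φ α) ψ) * MvPolynomial.X (l, α)

/-- The input state `∏ j, a†_(j, φ j) |0⟩`. -/
noncomputable def inputState (E : BosonSampler n m H) : E.Fock :=
  ∏ j, E.creation (E.inMode j) (E.φ j)

/-- The action of the interferometer on Fock space: it sends the creation operator
`a†_(j, Φ α)` to `∑ l, U l j b†_(l, Φ α)` and does not touch the internal states. -/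
noncomputable def interferometer (E : BosonSampler n m H) : E.Fock →ₐ[ℂ] E.Fock :=
  MvPolynomial.aeval fun p => ∑ l, MvPolynomial.C (E.U l p.1) * MvPolynomial.X (l, p.2)

/-- The output state. -/
noncomputable def outputState (E : BosonSampler n m H) : E.Fock := E.interferometer E.inputState

/-- The amplitude `⟨t | Ψ_out⟩` of the occupation number state `|t⟩ = X ^ t / √(∏ t!)`. -/
noncomputable def amplitude (E : BosonSampler n m H) (t : Fin m × Fin E.d →₀ ℕ) : ℂ :=
  (Real.sqrt (∏ p, ((t p).factorial : ℝ)) : ℂ) * E.outputState.coeff t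

/-- The marginal photon number distribution of the output modes `M 0, …, M (K - 1)`: the
probability of finding exactly `k z` photons (of whatever internal state) in mode `M z` for
every `z`.  The occupation numbers outside the support of the output state have amplitude `0`. -/
noncomputable def marginal (E : BosonSampler n m H) (M : Fin K ↪ Fin m) (k : Fin K → ℕ) : ℝ :=
  ∑ t ∈ E.outputState.support with ∀ z, ∑ α, t (M z, α) = k z, ‖E.amplitude t‖ ^ 2

/-- The generating (characteristic) function of the marginal,
`x(η) = ∑ k ∈ {0, …, n} ^ K, P(k) exp (i η · k)`. -/
noncomputable def genFun (E : BosonSampler n m H) (M : Fin K ↪ Fin m) (η : Fin K → ℝ) : ℂ :=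
  ∑ k : Fin K → Fin (n + 1), (E.marginal M (fun z => (k z : ℕ)) : ℂ) *
    Complex.exp (Complex.I * ∑ z, (η z : ℂ) * ((k z : ℕ) : ℂ))

/-- The diagonal matrix `Λ(η)`, with entry `exp (i η z)` at the mode `M z` and `1` at all other
modes. -/
noncomputable def Lam (M : Fin K ↪ Fin m) (η : Fin K → ℝ) : Matrix (Fin m) (Fin m) ℂ :=
  Matrix.diagonal fun l => ∏ z, if M z = l then Complex.exp (Complex.I * (η z : ℂ)) else 1

/-- The upper left `n × n` block of `W(η) = U† (Λ(η) - 1) U`. -/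
noncomputable def W (E : BosonSampler n m H) (M : Fin K ↪ Fin m) (η : Fin K → ℝ) :
    Matrix (Fin n) (Fin n) ℂ :=
  (E.U.conjTranspose * (Lam M η - 1) * E.U).submatrix E.inMode E.inMode

end BosonSampler

/-! ## Exact computation over the complex numbers: a unit-cost random access machine

Programs work on arrays of natural numbers (for counters and addresses) and on two-dimensional
arrays of complex numbers.  Complex numbers can be combined by exact arithmetic operations and
tested for equality; natural numbers can be added, subtracted (truncated) and compared.  Each
operation, memory access, test, assignment and loop iteration costs one step.  The only iteration
is a `for` loop, so that each program terminates. -/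

namespace CRam

structure Store where
  /-- arrays of natural numbers: `N a i` is the entry `i` of the array `a` -/
  N : ℕ → ℕ → ℕ
  /-- arrays of complex numbers: `C a i j` is the entry `(i, j)` of the array `a` -/
  C : ℕ → ℕ → ℕ → ℂ

/-- Set the entry `i` of the natural number array `a`. -/
def Store.setN (s : Store) (a i v : ℕ) : Store :=
  { s with N := fun b j => if b = a ∧ j = i then v else s.N b j }

/-- Set the entry `(i, j)` of the complex array `a`. -/
def Store.setC (s : Store) (a i j : ℕ) (v : ℂ) : Store :=
  { s with C := fun b k l => if b = a ∧ k = i ∧ l = j then v else s.C b k l }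

/-- Expressions for natural numbers. -/
inductive NExpr where
  | lit (c : ℕ)
  | get (a : ℕ) (i : NExpr)
  | add (e f : NExpr)
  | sub (e f : NExpr)

def NExpr.eval (s : Store) : NExpr → ℕ
  | .lit c => c
  | .get a i => s.N a (i.eval s)
  | .add e f => e.eval s + f.eval s
  | .sub e f => e.eval s - f.eval s

def NExpr.cost : NExpr → ℕ
  | .lit _ => 1
  | .get _ i => i.cost + 1
  | .add e f => e.cost + f.cost + 1
  | .sub e f => e.cost + f.cost + 1

/-- Expressions for complex numbers. -/
inductive CExpr where
  | ofNat (e : NExpr)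
  | get (a : ℕ) (i j : NExpr)
  | add (e f : CExpr)
  | sub (e f : CExpr)
  | mul (e f : CExpr)
  | div (e f : CExpr)
  | conj (e : CExpr)

noncomputable def CExpr.eval (s : Store) : CExpr → ℂ
  | .ofNat e => (e.eval s : ℂ)
  | .get a i j => s.C a (i.eval s) (j.eval s)
  | .add e f => e.eval s + f.eval s
  | .sub e f => e.eval s - f.eval s
  | .mul e f => e.eval s * f.eval s
  | .div e f => e.eval s / f.eval s
  | .conj e => star (e.eval s)

def CExpr.cost : CExpr → ℕ
  | .ofNat e => e.cost + 1
  | .get _ i j => i.cost + j.cost + 1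
  | .add e f => e.cost + f.cost + 1
  | .sub e f => e.cost + f.cost + 1
  | .mul e f => e.cost + f.cost + 1
  | .div e f => e.cost + f.cost + 1
  | .conj e => e.cost + 1

/-- Tests: `e < f` for natural numbers, `e = f` for complex numbers. -/
inductive Test where
  | lt (e f : NExpr)
  | eq (e f : CExpr)

def Test.holds (s : Store) : Test → Prop
  | .lt e f => e.eval s < f.eval s
  | .eq e f => e.eval s = f.eval s

def Test.cost : Test → ℕ
  | .lt e f => e.cost + f.cost + 1
  | .eq e f => e.cost + f.cost + 1

/-- Programs. -/
inductive Prog where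
  | skip
  /-- `N a i := e` -/
  | setN (a : ℕ) (i e : NExpr)
  /-- `C a i j := e` -/
  | setC (a : ℕ) (i j : NExpr) (e : CExpr)
  /-- first `p`, then `q` -/
  | seq (p q : Prog)
  /-- if `t` holds then `p`, else `q` -/
  | ite (t : Test) (p q : Prog)
  /-- for `N a 0 := 0, 1, …, e - 1` do `p`, where `e` is evaluated once, before the loop -/
  | loop (a : ℕ) (e : NExpr) (p : Prog)

/-- The first `k` rounds of a `for` loop with counter `N a 0` and body `f`. -/
def loopRun (f : Store → Store × ℕ) (a : ℕ) (s : Store) : ℕ → Store × ℕ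
  | 0 => (s, 0)
  | k + 1 =>
      ((f ((loopRun f a s k).1.setN a 0 k)).1,
        (loopRun f a s k).2 + 1 + (f ((loopRun f a s k).1.setN a 0 k)).2)

open Classical in
/-- The store after a run of the program from a given store, and the number of steps taken. -/
noncomputable def Prog.run : Prog → Store → Store × ℕ
  | .skip, s => (s, 1)
  | .setN a i e, s => (s.setN a (i.eval s) (e.eval s), i.cost + e.cost + 1)
  | .setC a i j e, s => (s.setC a (i.eval s) (j.eval s) (e.eval s), i.cost + j.cost + e.cost + 1)
  | .seq p q, s => ((q.run (p.run s).1).1, (p.run s).2 + (q.run (p.run s).1).2)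
  | .ite t p q, s =>
      if t.holds s then ((p.run s).1, t.cost + (p.run s).2)
      else ((q.run s).1, t.cost + (q.run s).2)
  | .loop a e p, s =>
      ((loopRun p.run a s (e.eval s)).1, e.cost + 1 + (loopRun p.run a s (e.eval s)).2)

/-- The initial store.  Array `0` of natural numbers holds `n`, `m`, `K`, array `1` the chosen
output modes.  Array `0` of complex numbers holds the matrix `U`, array `1` the matrix `S`,
array `2` the numbers `y z`.  Everything else is `0`. -/
def input {n m K : ℕ} (U : Matrix (Fin m) (Fin m) ℂ) (S : Matrix (Fin n) (Fin n) ℂ)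
    (M : Fin K ↪ Fin m) (y : Fin K → ℂ) : Store where
  N a i :=
    if a = 0 then (if i = 0 then n else if i = 1 then m else if i = 2 then K else 0)
    else if a = 1 then (if h : i < K then (M ⟨i, h⟩ : ℕ) else 0)
    else 0
  C a i j :=
    if a = 0 then (if h : i < m ∧ j < m then U ⟨i, h.1⟩ ⟨j, h.2⟩ else 0)
    else if a = 1 then (if h : i < n ∧ j < n then S ⟨i, h.1⟩ ⟨j, h.2⟩ else 0)
    else if a = 2 then (if h : i < K ∧ j = 0 then y ⟨i, h.1⟩ else 0)
    else 0

end CRam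

/-!
The output state is a product of linear forms in the creation operators, and the Fock inner product
of two products of linear forms is the permanent of the matrix of their pairwise inner products
(`permanent_factored`: both sides count pairs of labellings of the photons by modes that differ by
a permutation). Weighting the output mode `M z` by `y z` gives the generating function, so
`∑ k, P(k) ∏ z, y z ^ k z = perm (1 + W(y) ⊙ S)` for all complex `y` (`sum_marginal_eq_permanent`).
Each selected mode contributes to `W(y)` a term `D S D'` with `D`, `D'` diagonal after the entrywise
product with `S`, hence `rank (W(y) ⊙ S) ≤ K rank S`.

For a matrix `∑ s, u_s v_sᵀ` with `t` terms, `perm (1 + ∑ s, u_s v_sᵀ)` is the image of the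
polynomial `∏ i, (1 + (∑ s, u_s i x_s) (∑ s, v_s i y_s))` under the functional that sends
`x ^ p y ^ q` to `∏ s, (p s)!` if `p = q` and to `0` otherwise (`permanent_one_add_lowRank`). All
degrees are at most `n`, so the `2 t` variables can be packed into one by a Kronecker substitution
with base `n + 1`: the polynomial becomes an array of `(n + 1) ^ (2 t)` coefficients, and the `n`
factors are multiplied in one after the other. The vectors `u_s`, `v_s` come from Gaussian
elimination, in which each pivot lowers the rank, so that `t ≤ rank (W ⊙ S) ≤ K r`
(`eliminateProg_spec`). The total time is `O(n ^ 3 + n ^ (2 K r + 1))` (`coreProg_spec`), which is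
`O(n ^ (2 K r + 1))` for `K, r ≥ 1`; for `K = 0` the generating function is `1`.

For the marginal, the arguments `y z = a ^ ((n + 1) ^ z)` turn the generating function into a
polynomial in `a` of degree less than `(n + 1) ^ K` with the probabilities as its coefficients. It
is evaluated at `a = 0, …, (n + 1) ^ K - 1` and interpolated (`marginalProg_spec`).
-/

/-! ### Permanents as sums over labellings -/

namespace BosonSampling

variable {ι L : Type*} [Fintype ι]

/-- The occupation numbers of a labelling `σ`: `occ σ l` is the number of `i` with `σ i = l`. -/
noncomputable def occ (σ : ι → L) : L →₀ ℕ := ∑ i, Finsupp.single (σ i) 1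

theorem occ_apply [DecidableEq L] (σ : ι → L) (l : L) : occ σ l = Fintype.card {i // σ i = l} := by
  simp [occ, Finsupp.finsetSum_apply, Finsupp.single_apply, Fintype.card_subtype]

/-- Two labellings with the same occupation numbers differ by a permutation, which is unique up
to the permutations within the fibres. -/
theorem card_perm_comp_eq [DecidableEq ι] [DecidableEq L] [Fintype L] (σ τ : ι → L) :
    Fintype.card {π : Equiv.Perm ι // τ ∘ π = σ} =
      if occ σ = occ τ then ∏ l, (occ σ l).factorial else 0 := by
  split_ifs with h
  · have e : ∀ l, {i // σ i = l} ≃ {i // τ i = l} := fun l => by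
      have hl := DFunLike.congr_fun h l
      rw [occ_apply, occ_apply] at hl
      exact Fintype.equivOfCardEq (by convert hl)
    let π₀ : Equiv.Perm ι := Equiv.ofFiberEquiv e
    have hπ₀ : ∀ i, τ (π₀ i) = σ i := fun i => Equiv.ofFiberEquiv_map e i
    have h1 : Fintype.card {π : Equiv.Perm ι // τ ∘ π = σ} =
        Fintype.card {π : Equiv.Perm ι // τ ∘ π = τ} := by
      refine Fintype.card_congr ((Equiv.mulRight π₀⁻¹).subtypeEquiv fun π => ?_)
      simp only [funext_iff, Function.comp_apply, Equiv.coe_mulRight, Equiv.Perm.coe_mul]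
      constructor
      · intro H i
        rw [H, ← hπ₀]; simp
      · intro H i
        have := H (π₀ i)
        simpa [hπ₀] using this
    rw [h1, DomMulAct.stabilizer_card, h]
    simp only [occ_apply]
  · rw [Fintype.card_eq_zero_iff]
    refine ⟨fun ⟨π, hπ⟩ => h ?_⟩
    subst hπ
    exact Equiv.sum_comp π fun i => Finsupp.single (τ i) 1

/-- The permanent of a factored matrix as a sum over pairs of labellings. -/
theorem permanent_factored [DecidableEq ι] [DecidableEq L] {R : Type*} [CommRing R] [Fintype L]
    (u v : ι → L → R) :
    (Matrix.of fun i j => ∑ l, u i l * v j l).permanent =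
      ∑ σ : ι → L, ∑ τ : ι → L, if occ σ = occ τ then
        ((∏ l, (occ σ l).factorial : ℕ) : R) * ((∏ i, u i (σ i)) * ∏ i, v i (τ i)) else 0 := by
  have key : ∀ τ : ι → L, ∀ π : Equiv.Perm ι,
      ∏ i, u (π i) (τ i) * v i (τ i) =
        ∑ σ : ι → L, if τ ∘ π.symm = σ then (∏ i, u i (σ i)) * ∏ i, v i (τ i) else 0 := by
    intro τ π
    rw [Finset.sum_ite_eq, if_pos (Finset.mem_univ _), Finset.prod_mul_distrib]
    congr 1
    exact Fintype.prod_equiv π _ _ fun i => by simp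
  simp only [Matrix.permanent, Matrix.of_apply, Fintype.prod_sum]
  simp only [key]
  rw [Finset.sum_comm]
  conv_rhs => rw [Finset.sum_comm]
  refine Finset.sum_congr rfl fun τ _ => ?_
  rw [Finset.sum_comm]
  refine Finset.sum_congr rfl fun σ _ => ?_
  rw [← Finset.sum_filter, Finset.sum_const, nsmul_eq_mul]
  have : (Finset.univ.filter fun π : Equiv.Perm ι => τ ∘ π.symm = σ).card =
      Fintype.card {π : Equiv.Perm ι // τ ∘ π = σ} := by
    rw [← Fintype.card_subtype]
    exact Fintype.card_congr ((Equiv.inv (Equiv.Perm ι)).subtypeEquiv fun π => Iff.rfl)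
  rw [this, card_perm_comp_eq]
  split_ifs <;> simp

/-- The permanent of `1 + A` is the sum of the principal subpermanents of `A`. -/
theorem permanent_one_add {R : Type*} [CommRing R] [DecidableEq ι] (A : Matrix ι ι R) :
    (1 + A).permanent =
      ∑ T : Finset ι, (A.submatrix (Subtype.val : T → ι) Subtype.val).permanent := by
  simp only [Matrix.permanent, Matrix.add_apply, Matrix.submatrix_apply]
  have h1 : ∀ π : Equiv.Perm ι, ∏ i, ((1 : Matrix ι ι R) (π i) i + A (π i) i) =
      ∑ T : Finset ι, if ∀ i, i ∉ T → π i = i then ∏ i ∈ T, A (π i) i else 0 := by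
    intro π
    simp_rw [add_comm ((1 : Matrix ι ι R) _ _)]
    rw [Finset.prod_add, Finset.powerset_univ]
    refine Finset.sum_congr rfl fun T _ => ?_
    split_ifs with h
    · rw [Finset.prod_eq_one (s := Finset.univ \ T), mul_one]
      intro i hi
      rw [h i (by simpa using hi), Matrix.one_apply_eq]
    · push Not at h
      obtain ⟨i, hi, hi'⟩ := h
      exact mul_eq_zero_of_right _ (Finset.prod_eq_zero (i := i) (by simpa using hi)
        (Matrix.one_apply_ne hi'))
  simp only [h1]
  rw [Finset.sum_comm]
  refine Finset.sum_congr rfl fun T _ => ?_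
  rw [← Finset.sum_filter]
  symm
  refine Finset.sum_bij' (fun π _ => (Equiv.Perm.subtypeEquivSubtypePerm (· ∈ T) π).1)
    (fun π hπ => (Equiv.Perm.subtypeEquivSubtypePerm (· ∈ T)).symm
      ⟨π, by simpa using hπ⟩) ?_ ?_ ?_ ?_ ?_
  · intro π _
    simp only [Finset.mem_filter, Finset.mem_univ, true_and]
    exact (Equiv.Perm.subtypeEquivSubtypePerm (· ∈ T) π).2
  · simp
  · intro π _
    simp
  · intro π hπ
    have := (Equiv.Perm.subtypeEquivSubtypePerm (· ∈ T)).apply_symm_apply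
      ⟨π, by simpa using hπ⟩
    exact congrArg Subtype.val this
  · intro π _
    rw [← Finset.prod_coe_sort T]
    refine Finset.prod_congr rfl fun i _ => ?_
    rw [Equiv.Perm.subtypeEquivSubtypePerm_apply_of_mem]

end BosonSampling

/-! ### Permanents of low-rank perturbations of the identity -/

namespace BosonSampling

/-- The product of the factorials of the base `b` digits of `x`. -/
def digitWeight (b x : ℕ) : ℕ := ((Nat.digits b x).map Nat.factorial).prod

@[simp]
theorem digitWeight_zero (b : ℕ) : digitWeight b 0 = 1 := by simp [digitWeight]

theorem digitWeight_add_mul {b d : ℕ} (hb : 1 < b) (hd : d < b) (g : ℕ) :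
    digitWeight b (d + b * g) = d.factorial * digitWeight b g := by
  by_cases h : d ≠ 0 ∨ g ≠ 0
  · simp [digitWeight, Nat.digits_add b hb d g hd h]
  · push Not at h
    simp [h.1, h.2]

theorem digitWeight_sum {b : ℕ} (hb : 1 < b) : ∀ {t : ℕ} (p : Fin t → ℕ), (∀ s, p s < b) →
    digitWeight b (∑ s, p s * b ^ (s : ℕ)) = ∏ s, (p s).factorial
  | 0, _, _ => by simp
  | t + 1, p, hp => by
    have h : ∑ s, p s * b ^ (s : ℕ) = p 0 + b * ∑ s : Fin t, p s.succ * b ^ (s : ℕ) := by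
      rw [Fin.sum_univ_succ, Finset.mul_sum]
      simp [pow_succ, mul_comm, mul_left_comm]
    rw [h, digitWeight_add_mul hb (hp 0), Fin.prod_univ_succ,
      digitWeight_sum hb (fun s : Fin t => p s.succ) fun s => hp _]

theorem sum_mul_pow_lt {b t : ℕ} (p : Fin t → ℕ) (hp : ∀ s, p s < b) :
    ∑ s, p s * b ^ (s : ℕ) < b ^ t := by
  have := (finFunctionFinEquiv fun s => (⟨p s, hp s⟩ : Fin b)).2
  rwa [finFunctionFinEquiv_apply] at this

theorem sum_mul_pow_inj {b t : ℕ} {p q : Fin t → ℕ} (hp : ∀ s, p s < b) (hq : ∀ s, q s < b)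
    (h : ∑ s, p s * b ^ (s : ℕ) = ∑ s, q s * b ^ (s : ℕ)) : p = q := by
  have := finFunctionFinEquiv.injective (a₁ := fun s => (⟨p s, hp s⟩ : Fin b))
    (a₂ := fun s => (⟨q s, hq s⟩ : Fin b)) (Fin.ext (by
      rw [finFunctionFinEquiv_apply, finFunctionFinEquiv_apply]; exact h))
  funext s
  simpa using congrFun this s

variable {ι : Type*} [Fintype ι]

theorem sum_pow_eq_sum_occ {t : ℕ} (b : ℕ) (σ : ι → Fin t) :
    ∑ i, b ^ (σ i : ℕ) = ∑ s, occ σ s * b ^ (s : ℕ) := by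
  simp only [occ, Finsupp.finsetSum_apply, Finset.sum_mul]
  rw [Finset.sum_comm]
  simp [Finsupp.single_apply]

theorem occ_le_card {L : Type*} (σ : ι → L) (l : L) : occ σ l ≤ Fintype.card ι := by
  classical
  rw [occ_apply]
  exact Fintype.card_subtype_le _

/-- The polynomial `∏ i, (1 + (∑ s, u i s x_s) (∑ s, v i s y_s))` in `2 t` variables, packed into
one variable by the Kronecker substitution `x_s = X ^ (b ^ s)`, `y_s = X ^ (b ^ (t + s))`. -/
noncomputable def kronPoly (b : ℕ) {t : ℕ} (u v : ι → Fin t → ℂ) : Polynomial ℂ :=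
  ∏ i, (1 + (∑ s, Polynomial.C (u i s) * Polynomial.X ^ b ^ (s : ℕ)) *
    ∑ s, Polynomial.C (v i s) * Polynomial.X ^ b ^ (t + (s : ℕ)))

/-- The linear functional that sends `x ^ p y ^ q` (packed as in `kronPoly`) to `∏ s, (p s)!` if
`p = q` and to `0` otherwise. -/
noncomputable def diagSum (b t : ℕ) (f : Polynomial ℂ) : ℂ :=
  ∑ g ∈ Finset.range (b ^ t), (digitWeight b g : ℂ) * f.coeff (g + b ^ t * g)

theorem diagSum_sum {κ : Type*} (b t : ℕ) (S : Finset κ) (f : κ → Polynomial ℂ) :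
    diagSum b t (∑ k ∈ S, f k) = ∑ k ∈ S, diagSum b t (f k) := by
  simp only [diagSum, Polynomial.finsetSum_coeff, Finset.mul_sum]
  rw [Finset.sum_comm]

theorem diagSum_monomial {b t A B : ℕ} (hA : A < b ^ t) (hB : B < b ^ t) (c : ℂ) :
    diagSum b t (Polynomial.C c * Polynomial.X ^ (A + b ^ t * B)) =
      if A = B then (digitWeight b A : ℂ) * c else 0 := by
  have hiff : ∀ g ∈ Finset.range (b ^ t), (g + b ^ t * g = A + b ^ t * B ↔ g = A ∧ A = B) := by
    intro g hg
    rw [Finset.mem_range] at hg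
    constructor
    · intro h
      have h1 : g = A := by
        have := congrArg (· % b ^ t) h
        simpa [Nat.mod_eq_of_lt hg, Nat.mod_eq_of_lt hA] using this
      subst h1
      exact ⟨rfl, Nat.eq_of_mul_eq_mul_left (by omega) (Nat.add_left_cancel h)⟩
    · rintro ⟨rfl, rfl⟩; rfl
  simp only [diagSum, Polynomial.coeff_C_mul, Polynomial.coeff_X_pow]
  rw [Finset.sum_congr rfl fun g hg => by rw [if_congr (hiff g hg) rfl rfl]]
  split_ifs with h
  · rw [Finset.sum_eq_single A]
    · simp [h]
    · intro g _ hg; simp [hg]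
    · intro hA'; exact absurd (Finset.mem_range.2 hA) hA'
  · exact Finset.sum_eq_zero fun g _ => by simp [h]

theorem diagSum_prod [DecidableEq ι] {b t : ℕ} (hb : 1 < b) (hn : Fintype.card ι < b)
    (u v : ι → Fin t → ℂ) :
    diagSum b t (∏ i, (∑ s, Polynomial.C (u i s) * Polynomial.X ^ b ^ (s : ℕ)) *
      ∑ s, Polynomial.C (v i s) * Polynomial.X ^ b ^ (t + (s : ℕ))) =
    (Matrix.of fun i j => ∑ s, u i s * v j s).permanent := by
  classical
  rw [permanent_factored, Finset.prod_mul_distrib, Fintype.prod_sum, Fintype.prod_sum,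
    Finset.sum_mul_sum, diagSum_sum]
  refine Finset.sum_congr rfl fun σ _ => ?_
  rw [diagSum_sum]
  refine Finset.sum_congr rfl fun τ _ => ?_
  have hσ : ∀ s, occ σ s < b := fun s => (occ_le_card σ s).trans_lt hn
  have hτ : ∀ s, occ τ s < b := fun s => (occ_le_card τ s).trans_lt hn
  have h : (∏ i, Polynomial.C (u i (σ i)) * Polynomial.X ^ b ^ (σ i : ℕ)) *
      (∏ i, Polynomial.C (v i (τ i)) * Polynomial.X ^ b ^ (t + (τ i : ℕ))) =
      Polynomial.C ((∏ i, u i (σ i)) * ∏ i, v i (τ i)) *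
        Polynomial.X ^ ((∑ s, occ σ s * b ^ (s : ℕ)) + b ^ t * ∑ s, occ τ s * b ^ (s : ℕ)) := by
    rw [← sum_pow_eq_sum_occ, ← sum_pow_eq_sum_occ, Finset.mul_sum]
    simp only [Finset.prod_mul_distrib, Finset.prod_pow_eq_pow_sum, map_mul, map_prod, pow_add]
    ring
  rw [h, diagSum_monomial (sum_mul_pow_lt _ hσ) (sum_mul_pow_lt _ hτ), digitWeight_sum hb _ hσ]
  refine if_congr ⟨fun h => ?_, fun h => by rw [h]⟩ rfl rfl
  exact DFunLike.coe_injective (sum_mul_pow_inj hσ hτ h)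

/-- The permanent of a perturbation of the identity of rank `t`, as a contraction of a polynomial
in `2 t` variables. -/
theorem permanent_one_add_lowRank [DecidableEq ι] {b t : ℕ} (hb : 1 < b)
    (hn : Fintype.card ι < b) (u v : ι → Fin t → ℂ) :
    (1 + Matrix.of fun i j => ∑ s, u i s * v j s).permanent = diagSum b t (kronPoly b u v) := by
  rw [permanent_one_add, kronPoly, Finset.prod_one_add, Finset.powerset_univ, diagSum_sum]
  refine Finset.sum_congr rfl fun T _ => ?_
  rw [← Finset.prod_coe_sort T, diagSum_prod hb
    ((Fintype.card_subtype_le _).trans_lt hn) (fun i : T => u i) (fun i : T => v i)]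
  rfl

end BosonSampling

/-! ### The generating function of the marginal as a permanent -/

namespace BosonSampling

theorem rank_add_le {k l : Type*} [Fintype k] [Fintype l] (A B : Matrix k l ℂ) :
    (A + B).rank ≤ A.rank + B.rank := by
  rw [Matrix.rank, Matrix.rank, Matrix.rank, Matrix.mulVecLin_add]
  exact (Submodule.finrank_mono (LinearMap.range_add_le _ _)).trans
    (Submodule.finrank_add_le_finrank_add_finrank _ _)

theorem eq_zero_of_rank_eq_zero {k l : Type*} [Fintype k] [Fintype l] [DecidableEq l]
    {A : Matrix k l ℂ} (h : A.rank = 0) : A = 0 := by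
  rw [Matrix.rank, Submodule.finrank_eq_zero, LinearMap.range_eq_bot] at h
  exact Matrix.toLin'.injective (by simpa [Matrix.toLin'_apply'] using h)

end BosonSampling

namespace BosonSampler

open BosonSampling

variable {n m K : ℕ} {H : Type*} [NormedAddCommGroup H] [InnerProductSpace ℂ H]

/-- The amplitude for the `j`-th photon to leave in the spatial mode `p.1` with the internal state
`Φ p.2`. -/
noncomputable def photonAmp (E : BosonSampler n m H) (j : Fin n) (p : Fin m × Fin E.d) : ℂ :=
  E.U p.1 (E.inMode j) * inner ℂ (E.Φ p.2) (E.φ j)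

/-- The block of `U† (Λ - 1) U` on the input modes, for the diagonal matrix `Λ` with the entry
`y z` at the mode `M z` and `1` at all other modes. The `y z` are arbitrary complex numbers; for
`y z = exp (i η z)` this is `W`. -/
noncomputable def coupling (E : BosonSampler n m H) (M : Fin K ↪ Fin m) (y : Fin K → ℂ) :
    Matrix (Fin n) (Fin n) ℂ :=
  Matrix.of fun i j => ∑ z, (y z - 1) * star (E.U (M z) (E.inMode i)) * E.U (M z) (E.inMode j)

/-- The diagonal entries of `Λ`; as `M` is injective, at most one factor differs from `1`. -/
def modeWeight (M : Fin K ↪ Fin m) (y : Fin K → ℂ) (l : Fin m) : ℂ :=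
  ∏ z, if M z = l then y z else 1

theorem modeWeight_sub_one (M : Fin K ↪ Fin m) (y : Fin K → ℂ) (l : Fin m) :
    modeWeight M y l - 1 = ∑ z, if M z = l then y z - 1 else 0 := by
  unfold modeWeight
  by_cases h : ∃ z, M z = l
  · obtain ⟨z, rfl⟩ := h
    simp [M.injective.eq_iff]
  · push Not at h
    simp [h]

theorem sum_modeWeight_sub_one (M : Fin K ↪ Fin m) (y : Fin K → ℂ) (f g : Fin m → ℂ) :
    ∑ l, f l * (modeWeight M y l - 1) * g l = ∑ z, (y z - 1) * f (M z) * g (M z) := by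
  simp only [modeWeight_sub_one, Finset.mul_sum, Finset.sum_mul]
  rw [Finset.sum_comm]
  refine Finset.sum_congr rfl fun z _ => ?_
  rw [Finset.sum_eq_single (M z)]
  · rw [if_pos rfl]; ring
  · intro l _ hl; simp [hl.symm]
  · simp

theorem W_eq_coupling (E : BosonSampler n m H) (M : Fin K ↪ Fin m) (η : Fin K → ℝ) :
    E.W M η = E.coupling M fun z => Complex.exp (Complex.I * (η z : ℂ)) := by
  ext i j
  have hL : Lam M η - 1 =
      Matrix.diagonal fun l =>
        modeWeight M (fun z => Complex.exp (Complex.I * (η z : ℂ))) l - 1 := by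
    rw [Lam, ← Matrix.diagonal_one, Matrix.diagonal_sub]
    rfl
  rw [W, hL, coupling, Matrix.submatrix_apply, Matrix.mul_apply, Matrix.of_apply,
    ← sum_modeWeight_sub_one M _ (fun l => star (E.U l (E.inMode i)))
      fun l => E.U l (E.inMode j)]
  simp [Matrix.mul_diagonal]

/-- The internal states of the photons lie in the span of `Φ`. -/
theorem sum_inner_mul_inner (E : BosonSampler n m H) (i j : Fin n) :
    ∑ α, inner ℂ (E.φ i) (E.Φ α) * inner ℂ (E.Φ α) (E.φ j) = E.S i j := by
  set P : H := ∑ α, inner ℂ (E.Φ α) (E.φ j) • E.Φ α with hP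
  have hin : ∀ x, inner ℂ x P = ∑ α, inner ℂ x (E.Φ α) * inner ℂ (E.Φ α) (E.φ j) := fun x => by
    simp [hP, mul_comm]
  have h1 : inner ℂ (E.φ j) P = (1 : ℂ) := by rw [hin]; exact E.complete j
  have h2 : inner ℂ P P = (1 : ℂ) := by
    rw [hin, ← E.complete j]
    refine Finset.sum_congr rfl fun α _ => ?_
    congr 1
    rw [hP, E.orthonormal.inner_left_fintype]
    exact inner_conj_symm _ _
  have h3 : inner ℂ P (E.φ j) = (1 : ℂ) := by rw [← inner_conj_symm, h1]; simp
  -- the projection `P` of `φ j` to the span of `Φ` has norm `1`, so nothing is lost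
  have h4 : E.φ j - P = 0 := by
    rw [← inner_self_eq_zero (𝕜 := ℂ), inner_sub_sub_self, h1, h2, h3,
      inner_self_eq_norm_sq_to_K, E.norm_φ]
    simp
  rw [← hin, ← sub_eq_zero.1 h4, S, Matrix.gram_apply]

theorem S_self (E : BosonSampler n m H) (i : Fin n) : E.S i i = 1 := by
  rw [S, Matrix.gram_apply, inner_self_eq_norm_sq_to_K, E.norm_φ]; simp

/-- The Gram matrix of the photons after the weighting of the output modes. -/
theorem sum_star_photonAmp_mul (E : BosonSampler n m H) (M : Fin K ↪ Fin m) (y : Fin K → ℂ)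
    (i j : Fin n) :
    ∑ p, star (E.photonAmp i p) * (modeWeight M y p.1 * E.photonAmp j p) =
      (1 + Matrix.hadamard (E.coupling M y) E.S) i j := by
  have hU : ∑ l, star (E.U l (E.inMode i)) * E.U l (E.inMode j) =
      (1 : Matrix (Fin n) (Fin n) ℂ) i j := by
    have := congrFun (congrFun (Matrix.mem_unitaryGroup_iff'.1 E.unitary) (E.inMode i))
      (E.inMode j)
    rw [Matrix.mul_apply] at this
    simp only [Matrix.star_apply] at this
    rw [this, Matrix.one_apply, Matrix.one_apply]
    simp [inMode]
  have hW : ∑ l, star (E.U l (E.inMode i)) * modeWeight M y l * E.U l (E.inMode j) =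
      (1 : Matrix (Fin n) (Fin n) ℂ) i j + E.coupling M y i j := by
    rw [← hU, coupling, Matrix.of_apply, ← sum_modeWeight_sub_one M y
      (fun l => star (E.U l (E.inMode i))) fun l => E.U l (E.inMode j), ← Finset.sum_add_distrib]
    exact Finset.sum_congr rfl fun l _ => by ring
  have h : ∑ p, star (E.photonAmp i p) * (modeWeight M y p.1 * E.photonAmp j p) =
      (∑ l, star (E.U l (E.inMode i)) * modeWeight M y l * E.U l (E.inMode j)) *
        ∑ α, inner ℂ (E.φ i) (E.Φ α) * inner ℂ (E.Φ α) (E.φ j) := by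
    rw [Fintype.sum_prod_type, Finset.sum_mul_sum]
    refine Finset.sum_congr rfl fun l _ => Finset.sum_congr rfl fun α _ => ?_
    have : star (inner ℂ (E.Φ α) (E.φ i)) = inner ℂ (E.φ i) (E.Φ α) := inner_conj_symm _ _
    rw [photonAmp, photonAmp, star_mul', this]
    ring
  rw [h, hW, sum_inner_mul_inner, Matrix.add_apply, Matrix.hadamard_apply, add_mul]
  congr 1
  by_cases hij : i = j
  · subst hij; simp [S_self]
  · simp [hij]

theorem outputState_eq (E : BosonSampler n m H) :
    E.outputState = ∏ j, ∑ p, MvPolynomial.C (E.photonAmp j p) * MvPolynomial.X p := by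
  rw [outputState, inputState, map_prod]
  refine Finset.prod_congr rfl fun j _ => ?_
  rw [creation, map_sum, Fintype.sum_prod_type_right]
  refine Finset.sum_congr rfl fun α _ => ?_
  rw [map_mul, interferometer, MvPolynomial.aeval_X, MvPolynomial.aeval_C,
    MvPolynomial.algebraMap_eq, Finset.mul_sum]
  refine Finset.sum_congr rfl fun l _ => ?_
  rw [photonAmp, map_mul]
  ring

theorem coeff_outputState (E : BosonSampler n m H) (t : Fin m × Fin E.d →₀ ℕ) :
    E.outputState.coeff t =
      ∑ σ : Fin n → Fin m × Fin E.d, if occ σ = t then ∏ j, E.photonAmp j (σ j) else 0 := by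
  rw [outputState_eq, Fintype.prod_sum, MvPolynomial.coeff_sum]
  refine Finset.sum_congr rfl fun σ _ => ?_
  have : ∏ j, (MvPolynomial.C (E.photonAmp j (σ j)) * MvPolynomial.X (σ j)) =
      MvPolynomial.monomial (occ σ) (∏ j, E.photonAmp j (σ j)) := by
    rw [occ, MvPolynomial.monomial_sum_prod]
    exact Finset.prod_congr rfl fun j _ => MvPolynomial.C_mul_X_eq_monomial
  rw [this, MvPolynomial.coeff_monomial]

/-- The occupation number of the spatial mode `l` (all internal states). -/
theorem sum_occ_fst (d : ℕ) (σ : Fin n → Fin m × Fin d) (l : Fin m) :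
    ∑ α, occ σ (l, α) = ∑ j, if (σ j).1 = l then 1 else 0 := by
  simp only [occ, Finsupp.finsetSum_apply]
  rw [Finset.sum_comm]
  refine Finset.sum_congr rfl fun j _ => ?_
  simp only [Finsupp.single_apply, Prod.ext_iff]
  by_cases h : (σ j).1 = l <;> simp [h]

theorem prod_pow_sum_occ (d : ℕ) (M : Fin K ↪ Fin m) (y : Fin K → ℂ)
    (σ : Fin n → Fin m × Fin d) :
    ∏ z, y z ^ (∑ α, occ σ (M z, α)) = ∏ j, modeWeight M y (σ j).1 := by
  simp only [sum_occ_fst, modeWeight]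
  rw [Finset.prod_comm]
  refine Finset.prod_congr rfl fun z _ => ?_
  rw [← Finset.prod_pow_eq_pow_sum]
  refine Finset.prod_congr rfl fun j _ => ?_
  by_cases h : (σ j).1 = M z <;> simp [h, eq_comm]

theorem exists_occ_eq (E : BosonSampler n m H) {t : Fin m × Fin E.d →₀ ℕ}
    (ht : t ∈ E.outputState.support) : ∃ σ : Fin n → Fin m × Fin E.d, occ σ = t := by
  rw [MvPolynomial.mem_support_iff, coeff_outputState] at ht
  obtain ⟨σ, _, hσ⟩ := Finset.exists_ne_zero_of_sum_ne_zero ht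
  exact ⟨σ, by by_contra h; simp [h] at hσ⟩

/-- Grouping the occupation numbers of the output state by the counts in the selected modes; no
count exceeds `n`, so every term occurs for exactly one `k`. -/
theorem sum_marginal_mul (E : BosonSampler n m H) (M : Fin K ↪ Fin m) (y : Fin K → ℂ) :
    ∑ k : Fin K → Fin (n + 1), (E.marginal M (fun z => (k z : ℕ)) : ℂ) * ∏ z, y z ^ (k z : ℕ) =
      ∑ t ∈ E.outputState.support,
        ((‖E.amplitude t‖ ^ 2 : ℝ) : ℂ) * ∏ z, y z ^ (∑ α, t (M z, α)) := by
  simp only [marginal, Complex.ofReal_sum, Finset.sum_filter, Finset.sum_mul]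
  rw [Finset.sum_comm]
  refine Finset.sum_congr rfl fun t ht => ?_
  obtain ⟨σ, rfl⟩ := E.exists_occ_eq ht
  have hle : ∀ z, ∑ α, occ σ (M z, α) < n + 1 := fun z => by
    rw [sum_occ_fst, Finset.sum_boole, Nat.lt_succ_iff]
    exact (Finset.card_le_univ _).trans_eq (Fintype.card_fin n)
  rw [Finset.sum_eq_single fun z => ⟨_, hle z⟩]
  · simp
  · intro k _ hk
    rw [if_neg]
    · simp
    · intro h
      exact hk (funext fun z => Fin.ext (h z).symm)
  · simp

/-- The generating function of the marginal is a matrix element of the weighting of the output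
modes between the output state and itself, which is the permanent of a Gram matrix. -/
theorem sum_marginal_eq_permanent (E : BosonSampler n m H) (M : Fin K ↪ Fin m) (y : Fin K → ℂ) :
    ∑ k : Fin K → Fin (n + 1), (E.marginal M (fun z => (k z : ℕ)) : ℂ) * ∏ z, y z ^ (k z : ℕ) =
      (1 + Matrix.hadamard (E.coupling M y) E.S).permanent := by
  have hG : 1 + Matrix.hadamard (E.coupling M y) E.S = Matrix.of fun i j =>
      ∑ p, star (E.photonAmp i p) * (modeWeight M y p.1 * E.photonAmp j p) := by
    ext i j
    rw [← sum_star_photonAmp_mul]; rfl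
  rw [sum_marginal_mul, hG, permanent_factored (fun i p => star (E.photonAmp i p))
    fun j p => modeWeight M y p.1 * E.photonAmp j p]
  -- a coefficient of the output state can vanish by interference, so the sum is first extended
  -- from the support to all occupation numbers of labellings
  set T : Finset (Fin m × Fin E.d →₀ ℕ) :=
    Finset.univ.image (occ : (Fin n → Fin m × Fin E.d) → _) with hT
  have hsub : E.outputState.support ⊆ T := fun t ht => by
    obtain ⟨σ, rfl⟩ := E.exists_occ_eq ht
    exact Finset.mem_image_of_mem _ (Finset.mem_univ _)
  rw [Finset.sum_subset hsub fun t _ ht => by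
    rw [amplitude, MvPolynomial.notMem_support_iff.1 ht]; simp]
  have hnorm : ∀ t, ((‖E.amplitude t‖ ^ 2 : ℝ) : ℂ) =
      ((∏ p, (t p).factorial : ℕ) : ℂ) *
        (star (E.outputState.coeff t) * E.outputState.coeff t) := fun t => by
    have h0 : (0 : ℝ) ≤ ∏ p, ((t p).factorial : ℝ) :=
      Finset.prod_nonneg fun _ _ => Nat.cast_nonneg _
    have h1 : star (E.outputState.coeff t) * E.outputState.coeff t =
        ((‖E.outputState.coeff t‖ ^ 2 : ℝ) : ℂ) := by
      rw [mul_comm]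
      simpa using Complex.mul_conj' (E.outputState.coeff t)
    rw [h1, amplitude, norm_mul, mul_pow, Complex.norm_real, Real.norm_eq_abs, sq_abs,
      Real.sq_sqrt h0]
    push_cast
    rfl
  have hterm : ∀ t ∈ T, ((‖E.amplitude t‖ ^ 2 : ℝ) : ℂ) * ∏ z, y z ^ (∑ α, t (M z, α)) =
      ∑ σ : Fin n → Fin m × Fin E.d, ∑ τ : Fin n → Fin m × Fin E.d,
        if occ σ = t then if occ τ = t then ((∏ p, (occ σ p).factorial : ℕ) : ℂ) *
          ((∏ i, star (E.photonAmp i (σ i))) *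
            ∏ j, modeWeight M y (τ j).1 * E.photonAmp j (τ j)) else 0 else 0 := by
    intro t _
    rw [hnorm, coeff_outputState, star_sum, Finset.sum_mul_sum, Finset.mul_sum, Finset.sum_mul]
    refine Finset.sum_congr rfl fun σ _ => ?_
    rw [Finset.mul_sum, Finset.sum_mul]
    refine Finset.sum_congr rfl fun τ _ => ?_
    by_cases h1 : occ σ = t
    · by_cases h2 : occ τ = t
      · rw [if_pos h1, if_pos h1, if_pos h2, if_pos h2, Finset.prod_mul_distrib,
          ← prod_pow_sum_occ, h1, h2, star_prod]
        ring
      · simp [h2]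
    · simp [h1]
  rw [Finset.sum_congr rfl hterm, Finset.sum_comm]
  refine Finset.sum_congr rfl fun σ _ => ?_
  rw [Finset.sum_comm]
  refine Finset.sum_congr rfl fun τ _ => ?_
  rw [Finset.sum_ite_eq, if_pos (Finset.mem_image_of_mem _ (Finset.mem_univ _))]
  exact if_congr eq_comm rfl rfl

theorem genFun_eq_permanent (E : BosonSampler n m H) (M : Fin K ↪ Fin m) (η : Fin K → ℝ) :
    E.genFun M η = (1 + Matrix.hadamard (E.W M η) E.S).permanent := by
  rw [W_eq_coupling, ← sum_marginal_eq_permanent, genFun]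
  refine Finset.sum_congr rfl fun k _ => ?_
  congr 1
  rw [Finset.mul_sum, Complex.exp_sum]
  refine Finset.prod_congr rfl fun z _ => ?_
  rw [← Complex.exp_nat_mul]
  congr 1
  ring

theorem rank_coupling_hadamard_le (E : BosonSampler n m H) (M : Fin K ↪ Fin m) (y : Fin K → ℂ) :
    (Matrix.hadamard (E.coupling M y) E.S).rank ≤ K * E.S.rank := by
  have h : Matrix.hadamard (E.coupling M y) E.S = ∑ z,
      Matrix.diagonal (fun i => (y z - 1) * star (E.U (M z) (E.inMode i))) * E.S *
        Matrix.diagonal (fun j => E.U (M z) (E.inMode j)) := by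
    ext i j
    rw [Matrix.sum_apply, Matrix.hadamard_apply, coupling, Matrix.of_apply, Finset.sum_mul]
    refine Finset.sum_congr rfl fun z _ => ?_
    rw [Matrix.mul_diagonal, Matrix.diagonal_mul]
    ring
  have hsum : ∀ (s : Finset (Fin K)) (f : Fin K → Matrix (Fin n) (Fin n) ℂ) (r : ℕ),
      (∀ z, (f z).rank ≤ r) → (∑ z ∈ s, f z).rank ≤ s.card * r := by
    intro s f r hf
    induction s using Finset.cons_induction with
    | empty => simp
    | cons a s ha ih =>
      rw [Finset.sum_cons, Finset.card_cons, add_mul, one_mul, add_comm]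
      exact (rank_add_le _ _).trans (add_le_add ih (hf a))
  rw [h]
  refine (hsum Finset.univ _ E.S.rank fun z => ?_).trans_eq (by simp)
  exact (Matrix.rank_mul_le_left _ _).trans (Matrix.rank_mul_le_right _ _)

theorem S_eq_of_forall_eq (E : BosonSampler n m H) (h : ∀ i j, E.φ i = E.φ j) (i j : Fin n) :
    E.S i j = 1 := by
  rw [← E.S_self i, S, Matrix.gram_apply, Matrix.gram_apply, h j i]

theorem rank_S_of_forall_eq (E : BosonSampler n m H) (hn : 1 ≤ n) (h : ∀ i j, E.φ i = E.φ j) :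
    E.S.rank = 1 := by
  have hS : E.S = Matrix.vecMulVec (fun _ => 1) fun _ => 1 := by
    ext i j
    rw [E.S_eq_of_forall_eq h]; simp [Matrix.vecMulVec_apply]
  refine le_antisymm (hS ▸ Matrix.rank_vecMulVec_le _ _) (Nat.one_le_iff_ne_zero.2 fun h0 => ?_)
  have h1 := E.S_self ⟨0, hn⟩
  rw [eq_zero_of_rank_eq_zero h0] at h1
  simp at h1

theorem rank_S_pos (E : BosonSampler n m H) (hn : 1 ≤ n) : 1 ≤ E.S.rank := by
  refine Nat.one_le_iff_ne_zero.2 fun h0 => ?_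
  have h1 := E.S_self ⟨0, hn⟩
  rw [eq_zero_of_rank_eq_zero h0] at h1
  simp at h1

end BosonSampler

/-! ### Program logic: correctness and running time -/

/-!
The arrays are used as follows. Natural numbers: `0`, `1` the input; `2`, `3`, `4`, `6`, `11`, `13`,
`15` loop counters; `7` the pivot column; `8` the number of terms of the decomposition; `9` the
powers of `n + 1`; `10` an accumulator; `12` an exponent or address; `14` the number of
interpolation nodes. Complex numbers: `0` to `2` the input; `3` the output; `4` the matrix to be
decomposed; `5`, `6` its factors; `7` the partial products; `8` the factorials; `9` the weights;
`10` the value of the generating function; `11` the Lagrange basis polynomial; `12` an accumulator.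

The numerical constants in the time bounds are generous and carry no information.
-/

namespace CRam

@[simp] theorem Store.setN_C (s : Store) (a i v : ℕ) : (s.setN a i v).C = s.C := rfl

@[simp] theorem Store.setC_N (s : Store) (a i j : ℕ) (v : ℂ) : (s.setC a i j v).N = s.N := rfl

theorem Store.setN_N (s : Store) (a i v b j : ℕ) :
    (s.setN a i v).N b j = if b = a ∧ j = i then v else s.N b j := rfl

theorem Store.setC_C (s : Store) (a i j : ℕ) (v : ℂ) (b k l : ℕ) :
    (s.setC a i j v).C b k l = if b = a ∧ k = i ∧ l = j then v else s.C b k l := rfl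

@[simp] theorem Store.setN_N_self (s : Store) (a i v : ℕ) : (s.setN a i v).N a i = v := by
  simp [setN_N]

theorem Store.setN_N_of_ne (s : Store) {a b : ℕ} (h : b ≠ a) (i v : ℕ) :
    (s.setN a i v).N b = s.N b := by
  funext j; simp [setN_N, h]

theorem Store.setC_C_of_ne (s : Store) {a b : ℕ} (h : b ≠ a) (i j : ℕ) (v : ℂ) :
    (s.setC a i j v).C b = s.C b := by
  funext k l; simp [setC_C, h]

/-- The scalar variable kept in the entry `0` of the array `a`. -/
abbrev NExpr.var (a : ℕ) : NExpr := .get a (.lit 0)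

/-- A numeral as a complex expression. -/
abbrev CExpr.lit (c : ℕ) : CExpr := .ofNat (.lit c)

infixr:30 ";;" => Prog.seq

/-- Whether the program contains an assignment to the natural number array `b`. -/
def Prog.modN : Prog → ℕ → Bool
  | .skip, _ => false
  | .setN a _ _, b => b == a
  | .setC _ _ _ _, _ => false
  | .seq p q, b => p.modN b || q.modN b
  | .ite _ p q, b => p.modN b || q.modN b
  | .loop a _ p, b => b == a || p.modN b

/-- Whether the program contains an assignment to the complex array `b`. -/
def Prog.modC : Prog → ℕ → Bool
  | .skip, _ => false
  | .setN _ _ _, _ => false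
  | .setC a _ _ _, b => b == a
  | .seq p q, b => p.modC b || q.modC b
  | .ite _ p q, b => p.modC b || q.modC b
  | .loop _ _ p, b => p.modC b

/-- The stores `s` and `s'` agree on all arrays that `p` does not assign to. -/
structure Frame (p : Prog) (s s' : Store) : Prop where
  N : ∀ b, p.modN b = false → s'.N b = s.N b
  C : ∀ b, p.modC b = false → s'.C b = s.C b

theorem loopRun_frame {p : Prog} (hp : ∀ s, Frame p s (p.run s).1) (a : ℕ) (e : NExpr)
    (s : Store) : ∀ k, Frame (.loop a e p) s (loopRun p.run a s k).1
  | 0 => ⟨fun _ _ => rfl, fun _ _ => rfl⟩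
  | k + 1 => by
    have ih := loopRun_frame hp a e s k
    have h := hp ((loopRun p.run a s k).1.setN a 0 k)
    refine ⟨fun b hb => ?_, fun b hb => ?_⟩
    · have hb' := hb
      simp only [Prog.modN, Bool.or_eq_false_iff, beq_eq_false_iff_ne] at hb'
      exact (h.N b hb'.2).trans ((Store.setN_N_of_ne _ hb'.1 _ _).trans (ih.N b hb))
    · exact (h.C b hb).trans (ih.C b hb)

theorem Prog.run_frame : ∀ (p : Prog) (s : Store), Frame p s (p.run s).1
  | .skip, _ => ⟨fun _ _ => rfl, fun _ _ => rfl⟩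
  | .setN a i e, s => ⟨fun b hb => s.setN_N_of_ne (by simpa [modN] using hb) _ _, fun _ _ => rfl⟩
  | .setC a i j e, s =>
    ⟨fun _ _ => rfl, fun b hb => s.setC_C_of_ne (by simpa [modC] using hb) _ _ _⟩
  | .seq p q, s => by
    have hp := run_frame p s
    have hq := run_frame q (p.run s).1
    refine ⟨fun b hb => ?_, fun b hb => ?_⟩
    · simp only [modN, Bool.or_eq_false_iff] at hb
      exact (hq.N b hb.2).trans (hp.N b hb.1)
    · simp only [modC, Bool.or_eq_false_iff] at hb
      exact (hq.C b hb.2).trans (hp.C b hb.1)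
  | .ite t p q, s => by
    have hp := run_frame p s
    have hq := run_frame q s
    rw [run]
    refine ⟨fun b hb => ?_, fun b hb => ?_⟩
    · simp only [modN, Bool.or_eq_false_iff] at hb
      split_ifs
      · exact hp.N b hb.1
      · exact hq.N b hb.2
    · simp only [modC, Bool.or_eq_false_iff] at hb
      split_ifs
      · exact hp.C b hb.1
      · exact hq.C b hb.2
  | .loop a e p, s => loopRun_frame (run_frame p) a e s _

/-- Started from `s`, the program `p` ends in a store with the property `Q` after at most `c`
steps. -/
structure Ensures (p : Prog) (s : Store) (c : ℕ) (Q : Store → Prop) : Prop where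
  post : Q (p.run s).1
  cost : (p.run s).2 ≤ c

namespace Ensures

variable {p q : Prog} {s : Store} {c c₁ c₂ : ℕ} {Q R : Store → Prop}

theorem mono (h : Ensures p s c Q) (hc : c ≤ c₁) : Ensures p s c₁ Q := ⟨h.1, h.2.trans hc⟩

theorem imp (h : Ensures p s c Q) (hQ : ∀ s', Frame p s s' → Q s' → R s') : Ensures p s c R :=
  ⟨hQ _ (p.run_frame s) h.1, h.2⟩

theorem skip (h : Q s) : Ensures .skip s 1 Q := ⟨h, le_rfl⟩

theorem setN {a : ℕ} {i e : NExpr} (h : Q (s.setN a (i.eval s) (e.eval s)))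
    (hc : i.cost + e.cost + 1 ≤ c) : Ensures (.setN a i e) s c Q := ⟨h, hc⟩

theorem setC {a : ℕ} {i j : NExpr} {e : CExpr}
    (h : Q (s.setC a (i.eval s) (j.eval s) (e.eval s)))
    (hc : i.cost + j.cost + e.cost + 1 ≤ c) : Ensures (.setC a i j e) s c Q := ⟨h, hc⟩

theorem seq (hp : Ensures p s c₁ R) (hq : ∀ s', Frame p s s' → R s' → Ensures q s' c₂ Q) :
    Ensures (p ;; q) s (c₁ + c₂) Q := by
  have h := hq _ (p.run_frame s) hp.1
  exact ⟨h.1, Nat.add_le_add hp.2 h.2⟩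

theorem ite {t : Test} (hp : t.holds s → Ensures p s c Q) (hq : ¬ t.holds s → Ensures q s c Q) :
    Ensures (.ite t p q) s (t.cost + c) Q := by
  by_cases h : t.holds s
  · have hr : (Prog.ite t p q).run s = ((p.run s).1, t.cost + (p.run s).2) := if_pos h
    exact ⟨hr ▸ (hp h).1, hr ▸ Nat.add_le_add_left (hp h).2 _⟩
  · have hr : (Prog.ite t p q).run s = ((q.run s).1, t.cost + (q.run s).2) := if_neg h
    exact ⟨hr ▸ (hq h).1, hr ▸ Nat.add_le_add_left (hq h).2 _⟩

/-- The rule for loops: the invariant `I k` holds after `k` rounds and must not depend on the loop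
counter, which is set before each round. The overhead of the loop is absorbed in the factor `2`, so
that the bounds of nested loops remain products. -/
theorem loop {a : ℕ} {e : NExpr} {N : ℕ} (hN : e.eval s = N) (he : e.cost + 2 ≤ c)
    (I : ℕ → Store → Prop) (h0 : I 0 s)
    (hI : ∀ k s' v, I k s' → I k (s'.setN a 0 v))
    (hstep : ∀ k < N, ∀ s', Frame (.loop a e p) s s' → s'.N a 0 = k → I k s' →
      Ensures p s' c (I (k + 1))) :
    Ensures (.loop a e p) s (2 * c * (N + 1)) (I N) := by
  have key : ∀ k ≤ N, I k (loopRun p.run a s k).1 ∧ (loopRun p.run a s k).2 ≤ k * (c + 1) := by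
    intro k
    induction k with
    | zero => intro _; exact ⟨h0, le_of_eq (Nat.zero_mul _).symm⟩
    | succ k ih =>
      intro hk
      obtain ⟨ih1, ih2⟩ := ih (Nat.le_of_succ_le hk)
      have hF := loopRun_frame (Prog.run_frame p) a e s k
      have hF' : Frame (.loop a e p) s ((loopRun p.run a s k).1.setN a 0 k) := by
        refine ⟨fun b hb => ?_, fun b hb => hF.C b hb⟩
        have hb' := hb
        simp only [Prog.modN, Bool.or_eq_false_iff, beq_eq_false_iff_ne] at hb'
        exact (Store.setN_N_of_ne _ hb'.1 _ _).trans (hF.N b hb)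
      have h := hstep k hk _ hF' (Store.setN_N_self _ _ _ _) (hI k _ k ih1)
      refine ⟨h.1, ?_⟩
      have h2 := h.2
      simp only [loopRun]
      rw [Nat.succ_mul]
      omega
  obtain ⟨h1, h2⟩ := key N le_rfl
  have hr : (Prog.loop a e p).run s =
      ((loopRun p.run a s N).1, e.cost + 1 + (loopRun p.run a s N).2) := by rw [Prog.run, hN]
  refine ⟨hr ▸ h1, ?_⟩
  rw [hr]
  have : 2 * c * (N + 1) = N * (c + 1) + N * (c - 1) + 2 * c := by
    obtain ⟨d, rfl⟩ : ∃ d, c = d + 1 := ⟨c - 1, by omega⟩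
    simp only [Nat.add_sub_cancel]
    ring
  show e.cost + 1 + (loopRun p.run a s N).2 ≤ _
  omega

end Ensures

end CRam

/-! ### Programs: the entrywise product of the coupling and Gram matrices -/

namespace CRam

open NExpr (var)
open BosonSampling

/-- Fills `C 4` with the entrywise product of the coupling matrix and the Gram matrix. -/
def hadamardProg : Prog :=
  .loop 2 (var 0) (.loop 3 (var 0) (
    .setC 4 (var 2) (var 3) (.lit 0) ;;
    .loop 4 (.get 0 (.lit 2)) (
      .setC 4 (var 2) (var 3) (.add (.get 4 (var 2) (var 3))
        (.mul (.mul (.mul (.sub (.get 2 (var 4) (.lit 0)) (.lit 1))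
          (.conj (.get 0 (.get 1 (var 4)) (var 2))))
          (.get 0 (.get 1 (var 4)) (var 3))) (.get 1 (var 2) (var 3)))))))

/-- The summand of the mode `z` in the entry `(i, j)` of the matrix computed by `hadamardProg`. -/
noncomputable def hadamardTerm (s : Store) (i j z : ℕ) : ℂ :=
  (s.C 2 z 0 - 1) * star (s.C 0 (s.N 1 z) i) * s.C 0 (s.N 1 z) j * s.C 1 i j

theorem hadamardProg_spec {s : Store} {n K : ℕ} (hn : s.N 0 0 = n) (hK : s.N 0 2 = K) :
    Ensures hadamardProg s (360 * ((K + 1) * (n + 1) ^ 2)) fun s' => ∀ i < n, ∀ j < n,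
      s'.C 4 i j = ∑ z ∈ Finset.range K, hadamardTerm s i j z := by
  unfold hadamardProg
  refine .mono (.loop (N := n) (c := 180 * ((K + 1) * (n + 1))) (by exact hn) ?_
    (fun k s' => ∀ i < k, ∀ j < n, s'.C 4 i j = ∑ z ∈ Finset.range K, hadamardTerm s i j z)
    ?_ (fun _ _ _ h => h) ?_) ?_
  · simp only [NExpr.cost]; nlinarith [Nat.zero_le (K * n)]
  · intro i hi; omega
  · intro i hi s₁ hF₁ hk₁ hI₁
    have hN₁ : s₁.N 0 = s.N 0 := hF₁.N 0 rfl
    refine .mono (.imp (.loop (N := n) (c := 90 * (K + 1)) (by simp [NExpr.eval, hN₁, hn]) ?_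
      (fun k s' => (∀ i' < i, ∀ j < n,
          s'.C 4 i' j = ∑ z ∈ Finset.range K, hadamardTerm s i' j z) ∧
        ∀ j < k, s'.C 4 i j = ∑ z ∈ Finset.range K, hadamardTerm s i j z)
      ⟨hI₁, fun j hj => by omega⟩ (fun _ _ _ h => h) ?_) ?_) ?_
    · simp only [NExpr.cost]; omega
    · intro j hj s₂ hF₂ hk₂ hI₂
      have hi₂ : s₂.N 2 0 = i := (congrFun (hF₂.N 2 rfl) 0).trans hk₁
      have hN₂ : s₂.N 0 = s.N 0 := (hF₂.N 0 rfl).trans hN₁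
      refine .mono (.seq (c₁ := 7) (c₂ := 80 * (K + 1)) (R := fun s' => s'.C 4 i j = 0 ∧
        ∀ i' j', (i' = i ∧ j' = j) ∨ s'.C 4 i' j' = s₂.C 4 i' j') (.setC ?_ (by decide)) ?_) ?_
      · simp only [NExpr.eval, CExpr.eval, Store.setC_C, hi₂, hk₂]
        refine ⟨by simp, fun i' j' => ?_⟩
        by_cases h : i' = i ∧ j' = j
        · exact .inl h
        · exact .inr (by simp [h])
      · intro s₃ hF₃ hI₃
        have hN₃ : s₃.N 0 = s.N 0 := (hF₃.N 0 rfl).trans hN₂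
        refine .mono (.imp (.loop (N := K) (c := 40) (by simp [NExpr.eval, hN₃, hK]) (by decide)
          (fun k s' => s'.C 4 i j = ∑ z ∈ Finset.range k, hadamardTerm s i j z ∧
            ∀ i' j', (i' = i ∧ j' = j) ∨ s'.C 4 i' j' = s₂.C 4 i' j')
          ⟨by simpa using hI₃.1, hI₃.2⟩ (fun _ _ _ h => h) ?_) ?_) (by omega)
        · intro z hz s₄ hF₄ hk₄ hI₄
          have hi₄ : s₄.N 2 0 = i :=
            (congrFun ((hF₄.N 2 rfl).trans (hF₃.N 2 rfl)) 0).trans hi₂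
          have hj₄ : s₄.N 3 0 = j :=
            (congrFun ((hF₄.N 3 rfl).trans (hF₃.N 3 rfl)) 0).trans hk₂
          have h1 : s₄.N 1 = s.N 1 :=
            (hF₄.N 1 rfl).trans ((hF₃.N 1 rfl).trans ((hF₂.N 1 rfl).trans (hF₁.N 1 rfl)))
          have c0 : s₄.C 0 = s.C 0 :=
            (hF₄.C 0 rfl).trans ((hF₃.C 0 rfl).trans ((hF₂.C 0 rfl).trans (hF₁.C 0 rfl)))
          have c1 : s₄.C 1 = s.C 1 :=
            (hF₄.C 1 rfl).trans ((hF₃.C 1 rfl).trans ((hF₂.C 1 rfl).trans (hF₁.C 1 rfl)))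
          have c2 : s₄.C 2 = s.C 2 :=
            (hF₄.C 2 rfl).trans ((hF₃.C 2 rfl).trans ((hF₂.C 2 rfl).trans (hF₁.C 2 rfl)))
          refine .setC ?_ (by decide)
          simp only [NExpr.eval, CExpr.eval, Store.setC_C, hi₄, hj₄, hk₄, h1, c0, c1, c2, hI₄.1]
          refine ⟨?_, fun i' j' => ?_⟩
          · rw [Finset.sum_range_succ, hadamardTerm]; simp
          · by_cases h : i' = i ∧ j' = j
            · exact .inl h
            · exact .inr (by simpa [h] using (hI₄.2 i' j').resolve_left h)
        · intro s' _ h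
          refine ⟨fun i' hi' j' hj' => ?_, fun j' hj' => ?_⟩
          · rw [(h.2 i' j').resolve_left (by omega)]; exact hI₂.1 i' hi' j' hj'
          · rcases Nat.lt_succ_iff_lt_or_eq.1 hj' with hlt | rfl
            · rw [(h.2 i j').resolve_left (by omega)]; exact hI₂.2 j' hlt
            · exact h.1
      · omega
    · intro s' _ h i' hi' j hj
      rcases Nat.lt_succ_iff_lt_or_eq.1 hi' with hlt | rfl
      · exact h.1 i' hlt j hj
      · exact h.2 j hj
    · exact le_of_eq (by ring)
  · exact le_of_eq (by ring)

end CRam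

/-! ### Programs: decomposition into matrices of rank one -/

namespace BosonSampling

/-- A step of Gaussian elimination with a nonzero pivot lowers the rank: the kernel grows by the
standard vector of the pivot column. -/
theorem rank_eliminate_lt {k : Type*} [Fintype k] [DecidableEq k] (A : Matrix k k ℂ) {p q : k}
    (h : A p q ≠ 0) :
    (Matrix.of fun i j => A i j - A i q / A p q * A p j).rank < A.rank := by
  set B : Matrix k k ℂ := Matrix.of fun i j => A i j - A i q / A p q * A p j with hB
  have hmul : ∀ x i, B.mulVec x i = A.mulVec x i - A i q / A p q * A.mulVec x p := fun x i => by
    simp only [Matrix.mulVec, dotProduct, hB, Matrix.of_apply, sub_mul, Finset.sum_sub_distrib,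
      Finset.mul_sum, mul_assoc]
  have hlt : LinearMap.ker A.mulVecLin < LinearMap.ker B.mulVecLin := by
    refine lt_of_le_of_ne (fun x hx => ?_) fun heq => ?_
    · rw [LinearMap.mem_ker, Matrix.mulVecLin_apply] at hx ⊢
      funext i
      rw [hmul, hx]; simp
    · have h1 : Pi.single q 1 ∈ LinearMap.ker B.mulVecLin := by
        rw [LinearMap.mem_ker, Matrix.mulVecLin_apply]
        funext i
        rw [hmul, Matrix.mulVec_single_one]
        simp [h]
      rw [← heq, LinearMap.mem_ker, Matrix.mulVecLin_apply, Matrix.mulVec_single_one] at h1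
      exact h (congrFun h1 p)
  have h1 := Submodule.finrank_lt_finrank_of_lt hlt
  have h2 := A.mulVecLin.finrank_range_add_finrank_ker
  have h3 := B.mulVecLin.finrank_range_add_finrank_ker
  rw [Matrix.rank, Matrix.rank]
  omega

end BosonSampling

namespace CRam

open NExpr (var)
open BosonSampling

/-- The upper left `n × n` block of the complex array `C 4`. -/
def blockMatrix (n : ℕ) (s : Store) : Matrix (Fin n) (Fin n) ℂ := Matrix.of fun i j => s.C 4 i j

/-- Looks for a nonzero entry of the row `N 6 0` of `C 4`; its column goes to `N 7 0`, which is
`n` if the row is zero. -/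
def pivotProg : Prog :=
  .setN 7 (.lit 0) (var 0) ;;
  .loop 2 (var 0) (.ite (.eq (.get 4 (var 6) (var 2)) (.lit 0)) .skip
    (.setN 7 (.lit 0) (var 2)))

theorem pivotProg_spec {s : Store} {n : ℕ} (hn : s.N 0 0 = n) :
    Ensures pivotProg s (50 * (n + 1)) fun s' =>
      (s'.N 7 0 = n ∧ ∀ j < n, s.C 4 (s.N 6 0) j = 0) ∨
      (s'.N 7 0 < n ∧ s.C 4 (s.N 6 0) (s'.N 7 0) ≠ 0) := by
  unfold pivotProg
  refine .mono (.seq (c₁ := 4) (c₂ := 40 * (n + 1)) (R := fun s' => s'.N 7 0 = n)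
    (.setN (by simp [NExpr.eval, hn]) (by decide)) ?_) (by omega)
  intro s₁ hF₁ h₁
  have hN : s₁.N 0 = s.N 0 := hF₁.N 0 rfl
  refine .mono (.imp (.loop (N := n) (c := 20) (by simp [NExpr.eval, hN, hn]) (by decide)
    (fun k s' => (s'.N 7 0 = n ∧ ∀ j < k, s.C 4 (s.N 6 0) j = 0) ∨
      (s'.N 7 0 < n ∧ s.C 4 (s.N 6 0) (s'.N 7 0) ≠ 0)) (.inl ⟨h₁, by simp⟩) ?_ ?_) ?_)
    (by omega)
  · intro k s' v h
    rwa [Store.setN_N_of_ne _ (by decide)]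
  · intro k hk s₂ hF₂ hk₂ hI
    have h6 : s₂.N 6 = s.N 6 := (hF₂.N 6 rfl).trans (hF₁.N 6 rfl)
    have h4 : s₂.C 4 = s.C 4 := (hF₂.C 4 rfl).trans (hF₁.C 4 rfl)
    refine .mono (.ite (c := 5) (fun ht => ?_) fun ht => ?_) (by decide)
    · refine .mono (.skip ?_) (by omega)
      simp only [Test.holds, NExpr.eval, CExpr.eval, h6, h4, hk₂, Nat.cast_zero] at ht
      refine hI.imp (fun h => ⟨h.1, fun j hj => ?_⟩) id
      rcases Nat.lt_succ_iff_lt_or_eq.1 hj with hlt | rfl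
      · exact h.2 j hlt
      · exact ht
    · refine .setN ?_ (by decide)
      simp only [Test.holds, NExpr.eval, CExpr.eval, h6, h4, hk₂, Nat.cast_zero] at ht
      refine .inr ?_
      simp only [NExpr.eval, hk₂, Store.setN_N_self]
      exact ⟨hk, ht⟩
  · intro s' _ h; exact h

/-- Stores the column `N 7 0` of `C 4`, divided by the pivot, and the row `N 6 0` as the new rows
`N 8 0` of `C 5` and `C 6`. -/
def splitProg : Prog :=
  .loop 2 (var 0) (
    .setC 5 (var 8) (var 2)
      (.div (.get 4 (var 2) (var 7)) (.get 4 (var 6) (var 7))) ;;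
    .setC 6 (var 8) (var 2) (.get 4 (var 6) (var 2)))

theorem splitProg_spec {s : Store} {n : ℕ} (hn : s.N 0 0 = n) :
    Ensures splitProg s (60 * (n + 1)) fun s' =>
      (∀ k < s.N 8 0, s'.C 5 k = s.C 5 k ∧ s'.C 6 k = s.C 6 k) ∧
      ∀ i < n, s'.C 5 (s.N 8 0) i = s.C 4 i (s.N 7 0) / s.C 4 (s.N 6 0) (s.N 7 0) ∧
        s'.C 6 (s.N 8 0) i = s.C 4 (s.N 6 0) i := by
  unfold splitProg
  refine .mono (.loop (N := n) (c := 30) (by exact hn) (by decide)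
    (fun l s' => (∀ k < s.N 8 0, s'.C 5 k = s.C 5 k ∧ s'.C 6 k = s.C 6 k) ∧
      ∀ i < l, s'.C 5 (s.N 8 0) i = s.C 4 i (s.N 7 0) / s.C 4 (s.N 6 0) (s.N 7 0) ∧
        s'.C 6 (s.N 8 0) i = s.C 4 (s.N 6 0) i) (by simp) (fun _ _ _ h => h) ?_) (by omega)
  intro i hi s₁ hF hk hI
  have h6 := hF.N 6 rfl
  have h7 := hF.N 7 rfl
  have h8 := hF.N 8 rfl
  have h4 := hF.C 4 rfl
  refine ⟨?_, ?_⟩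
  · simp only [Prog.run, NExpr.eval, CExpr.eval, Store.setC_N, hk, h6, h7, h8,
      Store.setC_C_of_ne _ (show 4 ≠ 5 by decide), h4]
    refine ⟨fun k hk' => ⟨?_, ?_⟩, fun j hj => ?_⟩
    · rw [← (hI.1 k hk').1]
      funext j
      simp [Store.setC_C, hk'.ne]
    · rw [← (hI.1 k hk').2]
      funext j
      simp [Store.setC_C, hk'.ne]
    · rcases Nat.lt_succ_iff_lt_or_eq.1 hj with hlt | rfl
      · simpa [Store.setC_C, hlt.ne] using hI.2 j hlt
      · simp [Store.setC_C]
  · simp [Prog.run, NExpr.cost, CExpr.cost]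

/-- Subtracts from `C 4` the product of the rows `N 8 0` of `C 5` and `C 6`. -/
def subtractProg : Prog :=
  .loop 2 (var 0) (.loop 3 (var 0) (
    .setC 4 (var 2) (var 3) (.sub (.get 4 (var 2) (var 3))
      (.mul (.get 5 (var 8) (var 2)) (.get 6 (var 8) (var 3))))))

theorem subtractProg_spec {s : Store} {n : ℕ} (hn : s.N 0 0 = n) :
    Ensures subtractProg s (120 * (n + 1) ^ 2) fun s' => ∀ i < n, ∀ j < n,
      s'.C 4 i j = s.C 4 i j - s.C 5 (s.N 8 0) i * s.C 6 (s.N 8 0) j := by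
  unfold subtractProg
  refine .mono (.imp (.loop (N := n) (c := 60 * (n + 1)) (by exact hn)
    (by simp only [NExpr.cost]; omega)
    (fun k s' => ∀ i j, s'.C 4 i j = if i < k ∧ j < n then
      s.C 4 i j - s.C 5 (s.N 8 0) i * s.C 6 (s.N 8 0) j else s.C 4 i j)
    (by simp) (fun _ _ _ h => h) ?_) ?_) (le_of_eq (by ring))
  · intro i hi s₁ hF₁ hk₁ hI₁
    have hN : s₁.N 0 = s.N 0 := hF₁.N 0 rfl
    refine .mono (.imp (.loop (N := n) (c := 30) (by simp [NExpr.eval, hN, hn]) (by decide)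
      (fun k s' => ∀ i' j, s'.C 4 i' j = if i' < i ∧ j < n ∨ i' = i ∧ j < k then
        s.C 4 i' j - s.C 5 (s.N 8 0) i' * s.C 6 (s.N 8 0) j else s.C 4 i' j)
      (by simpa using hI₁) (fun _ _ _ h => h) ?_) ?_) (by omega)
    · intro j hj s₂ hF₂ hk₂ hI₂
      have hi₂ : s₂.N 2 0 = i := (congrFun (hF₂.N 2 rfl) 0).trans hk₁
      have h8 : s₂.N 8 = s.N 8 := (hF₂.N 8 rfl).trans (hF₁.N 8 rfl)
      have h5 : s₂.C 5 = s.C 5 := (hF₂.C 5 rfl).trans (hF₁.C 5 rfl)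
      have h6 : s₂.C 6 = s.C 6 := (hF₂.C 6 rfl).trans (hF₁.C 6 rfl)
      refine .setC ?_ (by decide)
      intro i' j'
      simp only [NExpr.eval, CExpr.eval, Store.setC_C, hi₂, hk₂, h8, h5, h6, hI₂]
      by_cases h : i' = i ∧ j' = j
      · obtain ⟨rfl, rfl⟩ := h
        simp
      · rw [if_neg (by simpa using h)]
        refine if_congr ?_ rfl rfl
        omega
    · intro s' _ h i' j
      rw [h]
      refine if_congr ?_ rfl rfl
      omega
  · intro s' _ h i hi j hj
    rw [h, if_pos ⟨hi, hj⟩]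

/-- Decomposes the matrix in `C 4` into a sum of `N 8 0` matrices of rank one, the products of the
rows of `C 5` and `C 6`. For each row the search for a pivot takes time `O(n)` and the update time
`O(n ^ 2)`, so the total time is `O(n ^ 3)` whatever the rank. -/
def eliminateProg : Prog :=
  .setN 8 (.lit 0) (.lit 0) ;;
  .loop 6 (var 0) (pivotProg ;;
    .ite (.lt (var 7) (var 0))
      (splitProg ;; subtractProg ;; .setN 8 (.lit 0) (.add (var 8) (.lit 1))) .skip)

/-- The invariant of `eliminateProg` after the first `p` rows: they are zero in the current
matrix, and the number of terms is bounded by the loss of rank. -/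
structure EliminateInv (n : ℕ) (s : Store) (p : ℕ) (s' : Store) : Prop where
  decomp : ∀ i < n, ∀ j < n, s.C 4 i j =
    s'.C 4 i j + ∑ k ∈ Finset.range (s'.N 8 0), s'.C 5 k i * s'.C 6 k j
  zero : ∀ i < p, ∀ j < n, s'.C 4 i j = 0
  rank : (blockMatrix n s').rank + s'.N 8 0 ≤ (blockMatrix n s).rank

theorem EliminateInv.setN {n p : ℕ} {s s' : Store} (h : EliminateInv n s p s') {a : ℕ} (ha : 8 ≠ a)
    (i v : ℕ) : EliminateInv n s p (s'.setN a i v) := by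
  refine ⟨fun i hi j hj => ?_, h.2, ?_⟩
  · rw [Store.setN_N_of_ne _ ha]; exact h.1 i hi j hj
  · rw [Store.setN_N_of_ne _ ha]; exact h.3

theorem eliminateProg_spec {s : Store} {n : ℕ} (hn : s.N 0 0 = n) :
    Ensures eliminateProg s (1000 * (n + 1) ^ 3) fun s' =>
      s'.N 8 0 ≤ (blockMatrix n s).rank ∧ ∀ i < n, ∀ j < n,
        s.C 4 i j = ∑ k ∈ Finset.range (s'.N 8 0), s'.C 5 k i * s'.C 6 k j := by
  unfold eliminateProg
  have hpos : 1 ≤ (n + 1) ^ 3 := Nat.one_le_pow _ _ (Nat.succ_pos _)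
  refine .mono (.seq (c₁ := 3) (c₂ := 800 * (n + 1) ^ 3) (R := EliminateInv n s 0)
    (.setN ⟨by simp [NExpr.eval], by simp, ?_⟩ (by decide)) ?_) (by omega)
  · simp only [NExpr.eval, Store.setN_N_self]
    exact le_rfl
  intro s₁ hF₁ h₁
  have hN₁ : s₁.N 0 = s.N 0 := hF₁.N 0 rfl
  refine .mono (.imp (.loop (N := n) (c := 400 * (n + 1) ^ 2) (by simp [NExpr.eval, hN₁, hn])
    (by simp only [NExpr.cost]; nlinarith) (EliminateInv n s) h₁
    (fun _ _ _ h => h.setN (by decide) _ _) ?_) ?_) (le_of_eq (by ring))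
  · intro p hp s₂ hF₂ hk₂ hI
    have hN₂ : s₂.N 0 = s.N 0 := (hF₂.N 0 rfl).trans hN₁
    refine .mono (.seq (c₂ := 5 + (60 * (n + 1) + (120 * (n + 1) ^ 2 + 10)))
      (pivotProg_spec (by rw [hN₂, hn])) ?_) (by nlinarith)
    intro s₃ hF₃ h₃
    have hN₃ : s₃.N 0 = s.N 0 := (hF₃.N 0 rfl).trans hN₂
    have c4 : s₃.C 4 = s₂.C 4 := hF₃.C 4 rfl
    have c5 : s₃.C 5 = s₂.C 5 := hF₃.C 5 rfl
    have c6 : s₃.C 6 = s₂.C 6 := hF₃.C 6 rfl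
    have h8 : s₃.N 8 = s₂.N 8 := hF₃.N 8 rfl
    have h6 : s₃.N 6 0 = p := (congrFun (hF₃.N 6 rfl) 0).trans hk₂
    rw [hk₂] at h₃
    refine .ite (fun ht => ?_) fun ht => ?_
    · simp only [Test.holds, NExpr.eval, hN₃, hn] at ht
      obtain ⟨hq, hne⟩ := h₃.resolve_left (by omega)
      refine .seq (splitProg_spec (by rw [hN₃, hn])) ?_
      intro s₄ hF₄ h₄
      have hN₄ : s₄.N 0 = s.N 0 := (hF₄.N 0 rfl).trans hN₃
      refine .seq (subtractProg_spec (by rw [hN₄, hn])) ?_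
      intro s₅ hF₅ h₅
      refine .setN ?_ (by decide)
      have n8 : s₄.N 8 = s₂.N 8 := (hF₄.N 8 rfl).trans h8
      have e8 : s₅.N 8 = s₂.N 8 := (hF₅.N 8 rfl).trans n8
      have e4 : s₄.C 4 = s₂.C 4 := (hF₄.C 4 rfl).trans c4
      have e5 : s₅.C 5 = s₄.C 5 := hF₅.C 5 rfl
      have e6 : s₅.C 6 = s₄.C 6 := hF₅.C 6 rfl
      rw [h6, h8, c4, c5, c6] at h₄
      rw [n8, e4] at h₅
      set q := s₃.N 7 0
      have hnew : ∀ i < n, ∀ j < n, s₅.C 4 i j =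
          s₂.C 4 i j - s₂.C 4 i q / s₂.C 4 p q * s₂.C 4 p j := fun i hi j hj => by
        rw [h₅ i hi j hj, (h₄.2 i hi).1, (h₄.2 j hj).2]
      refine ⟨fun i hi j hj => ?_, fun i hi j hj => ?_, ?_⟩
      · simp only [NExpr.eval, Store.setN_N_self, Store.setN_C, e8, e5, e6]
        rw [Finset.sum_range_succ, hI.decomp i hi j hj, hnew i hi j hj, (h₄.2 i hi).1,
          (h₄.2 j hj).2, Finset.sum_congr rfl fun k hk => by
            rw [← (h₄.1 k (Finset.mem_range.1 hk)).1, ← (h₄.1 k (Finset.mem_range.1 hk)).2]]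
        ring
      · rw [Store.setN_C]
        rcases Nat.lt_succ_iff_lt_or_eq.1 hi with hlt | rfl
        · rw [hnew i (by omega) j hj, hI.zero i hlt j hj, hI.zero i hlt q hq]; simp
        · rw [hnew i hp j hj, div_self hne]; ring
      · simp only [NExpr.eval, Store.setN_N_self, e8]
        have hB : blockMatrix n (s₅.setN 8 0 (s₂.N 8 0 + 1)) = Matrix.of fun i j =>
            blockMatrix n s₂ i j - blockMatrix n s₂ i ⟨q, hq⟩ /
              blockMatrix n s₂ ⟨p, hp⟩ ⟨q, hq⟩ * blockMatrix n s₂ ⟨p, hp⟩ j := by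
          ext i j
          exact hnew i i.2 j j.2
        have := rank_eliminate_lt (blockMatrix n s₂) (p := ⟨p, hp⟩) (q := ⟨q, hq⟩) hne
        rw [← hB] at this
        have := hI.rank
        omega
    · refine .mono (.skip ?_) (Nat.succ_le_of_lt (by positivity))
      simp only [Test.holds, NExpr.eval, hN₃, hn] at ht
      obtain ⟨-, hz⟩ := h₃.resolve_right (fun h => ht h.1)
      refine ⟨?_, fun i hi j hj => ?_, ?_⟩
      · rw [c4, c5, c6, h8]; exact hI.decomp
      · rw [c4]
        rcases Nat.lt_succ_iff_lt_or_eq.1 hi with hlt | rfl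
        · exact hI.zero i hlt j hj
        · exact hz j hj
      · have : blockMatrix n s₃ = blockMatrix n s₂ := by
          unfold blockMatrix; rw [c4]
        rw [this, h8]; exact hI.rank
  · intro s' _ h
    refine ⟨(Nat.le_add_left _ _).trans h.rank, fun i hi j hj => ?_⟩
    rw [h.decomp i hi j hj, h.zero i hi j hj, zero_add]

end CRam

/-! ### Programs: powers and the packed polynomial -/

namespace CRam

open NExpr (var)
open BosonSampling

/-- Writes the powers `(n + 1) ^ k` with `k ≤ e` to `N 9`. -/
def powerProg (e : NExpr) : Prog :=
  .setN 9 (.lit 0) (.lit 1) ;;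
  .loop 2 e (
    .setN 10 (.lit 0) (.lit 0) ;;
    .loop 3 (.add (var 0) (.lit 1)) (.setN 10 (.lit 0) (.add (var 10) (.get 9 (var 2)))) ;;
    .setN 9 (.add (var 2) (.lit 1)) (var 10))

theorem powerProg_spec {s : Store} {n N : ℕ} {e : NExpr} (hn : s.N 0 0 = n)
    (he : ∀ s', Frame (powerProg e) s s' → e.eval s' = N) (hc : e.cost ≤ 10) :
    Ensures (powerProg e) s (250 * ((N + 1) * (n + 1))) fun s' =>
      ∀ k ≤ N, s'.N 9 k = (n + 1) ^ k := by
  have hpos : 1 ≤ (N + 1) * (n + 1) := Nat.mul_pos (Nat.succ_pos _) (Nat.succ_pos _)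
  refine .mono (.seq (c₁ := 3) (c₂ := 200 * ((N + 1) * (n + 1))) (R := fun s' => s'.N 9 0 = 1)
    (.setN (by simp [NExpr.eval]) (by decide)) ?_) (by omega)
  intro s₁ hF₁ h₁
  have hN₁ : s₁.N 0 = s.N 0 := hF₁.N 0 rfl
  have he₁ : e.eval s₁ = N := he _ ⟨fun b hb => hF₁.N b (by
    simp only [powerProg, Prog.modN, Bool.or_eq_false_iff] at hb ⊢; exact hb.1),
    fun b _ => hF₁.C b rfl⟩
  refine .mono (.imp (.loop (N := N) (c := 100 * (n + 1)) (by exact he₁) (by omega)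
    (fun k s' => ∀ l ≤ k, s'.N 9 l = (n + 1) ^ l) (by simpa using h₁) ?_ ?_)
    fun _ _ h => h) (le_of_eq (by ring))
  · intro k s' v h
    rwa [Store.setN_N_of_ne _ (by decide)]
  intro k hk s₂ hF₂ hk₂ hI
  have hN₂ : s₂.N 0 = s.N 0 := (hF₂.N 0 rfl).trans hN₁
  refine .mono (.seq (c₁ := 3) (c₂ := 40 * (n + 1 + 1) + 10) (R := fun s' => s'.N 10 0 = 0)
    (.setN (by simp [NExpr.eval]) (by decide)) ?_) (by omega)
  intro s₃ hF₃ h₃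
  have hN₃ : s₃.N 0 = s.N 0 := (hF₃.N 0 rfl).trans hN₂
  have h9 : s₃.N 9 = s₂.N 9 := hF₃.N 9 rfl
  have h2 : s₃.N 2 0 = k := (congrFun (hF₃.N 2 rfl) 0).trans hk₂
  refine .seq (.mono (.loop (N := n + 1) (c := 20) (by simp [NExpr.eval, hN₃, hn]) (by decide)
    (fun j s' => s'.N 10 0 = j * (n + 1) ^ k) (by simpa using h₃) ?_ ?_) (by omega)) ?_
  · intro j s' v h
    rwa [Store.setN_N_of_ne _ (by decide)]
  · intro j hj s₄ hF₄ hk₄ hI₄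
    refine .setN ?_ (by decide)
    simp only [NExpr.eval, Store.setN_N_self, (hF₄.N 2 rfl), (hF₄.N 9 rfl), h2, h9, hI₄,
      hI k le_rfl]
    ring
  · intro s₄ hF₄ h₄
    refine .setN ?_ (by decide)
    intro l hl
    simp only [NExpr.eval, (hF₄.N 2 rfl), h2, Store.setN_N]
    rcases Nat.lt_or_ge k l with hlt | hle
    · obtain rfl : l = k + 1 := by omega
      rw [if_pos (by simp), h₄]; ring
    · rw [if_neg (by omega), hF₄.N 9 rfl, h9, hI l hle]

/-- Writes the coefficients of the partial products of `kronPoly` to the rows of `C 7`. The row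
`i + 1` is the row `i` plus shifted multiples of it, one for each pair of labels. -/
def productProg : Prog :=
  .loop 11 (.get 9 (.add (var 8) (var 8))) (.setC 7 (.lit 0) (var 11) (.lit 0)) ;;
  .setC 7 (.lit 0) (.lit 0) (.lit 1) ;;
  .loop 2 (var 0) (.loop 11 (.get 9 (.add (var 8) (var 8))) (
    .setC 7 (.add (var 2) (.lit 1)) (var 11) (.get 7 (var 2) (var 11)) ;;
    .loop 3 (var 8) (.loop 4 (var 8) (
      .setN 12 (.lit 0) (.add (.get 9 (var 3)) (.get 9 (.add (var 8) (var 4)))) ;;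
      .ite (.lt (var 11) (var 12)) .skip
        (.setC 7 (.add (var 2) (.lit 1)) (var 11)
          (.add (.get 7 (.add (var 2) (.lit 1)) (var 11))
            (.mul (.mul (.get 5 (var 3) (var 2)) (.get 6 (var 4) (var 2)))
              (.get 7 (var 2) (.sub (var 11) (var 12))))))))))

/-- The product of the first `k` factors of `kronPoly`. -/
noncomputable def partialProduct (b t : ℕ) (u v : ℕ → ℕ → ℂ) (k : ℕ) : Polynomial ℂ :=
  ∏ i ∈ Finset.range k, (1 + (∑ s ∈ Finset.range t, Polynomial.C (u s i) * Polynomial.X ^ b ^ s) *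
    ∑ s ∈ Finset.range t, Polynomial.C (v s i) * Polynomial.X ^ b ^ (t + s))

/-- The contribution of the labels `x`, `y` of the photon `i` to a coefficient of the next partial
product. -/
noncomputable def productTerm (b t : ℕ) (u v : ℕ → ℕ → ℂ) (f : Polynomial ℂ) (i g x y : ℕ) : ℂ :=
  if g < b ^ x + b ^ (t + y) then 0
  else u x i * v y i * f.coeff (g - (b ^ x + b ^ (t + y)))

theorem coeff_partialProduct_succ (b t : ℕ) (u v : ℕ → ℕ → ℂ) (i g : ℕ) :
    (partialProduct b t u v (i + 1)).coeff g = (partialProduct b t u v i).coeff g +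
      ∑ x ∈ Finset.range t, ∑ y ∈ Finset.range t,
        productTerm b t u v (partialProduct b t u v i) i g x y := by
  conv_lhs => rw [partialProduct, Finset.prod_range_succ, ← partialProduct]
  rw [mul_add, mul_one, Polynomial.coeff_add, Finset.sum_mul_sum, Finset.mul_sum,
    Polynomial.finsetSum_coeff]
  congr 1
  refine Finset.sum_congr rfl fun x _ => ?_
  rw [Finset.mul_sum, Polynomial.finsetSum_coeff]
  refine Finset.sum_congr rfl fun y _ => ?_
  have h : partialProduct b t u v i * (Polynomial.C (u x i) * Polynomial.X ^ b ^ x *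
      (Polynomial.C (v y i) * Polynomial.X ^ b ^ (t + y))) =
      Polynomial.C (u x i * v y i) *
        (partialProduct b t u v i * Polynomial.X ^ (b ^ x + b ^ (t + y))) := by
    rw [map_mul, pow_add]; ring
  rw [h, Polynomial.coeff_C_mul, Polynomial.coeff_mul_X_pow', productTerm]
  by_cases hg : g < b ^ x + b ^ (t + y)
  · rw [if_pos hg, if_neg (by omega), mul_zero]
  · rw [if_neg hg, if_pos (by omega)]

theorem productProg_spec {s : Store} {n t b : ℕ} (hb : b = n + 1) (hn : s.N 0 0 = n)
    (ht : s.N 8 0 = t) (hp : ∀ k ≤ 2 * t, s.N 9 k = b ^ k) :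
    Ensures productProg s (4000 * ((t + 1) ^ 2 * b * (b ^ (2 * t) + 1))) fun s' =>
      ∀ g < b ^ (2 * t), s'.C 7 n g = (partialProduct b t (s.C 5) (s.C 6) n).coeff g := by
  unfold productProg
  have hpos : 1 ≤ (t + 1) ^ 2 * b :=
    Nat.mul_pos (Nat.pow_pos (Nat.succ_pos _)) (by omega)
  have hpos' : b ^ (2 * t) + 1 ≤ (t + 1) ^ 2 * b * (b ^ (2 * t) + 1) :=
    Nat.le_mul_of_pos_left _ hpos
  have hG : ∀ s', s'.N 8 = s.N 8 → s'.N 9 = s.N 9 →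
      (NExpr.get 9 (.add (var 8) (var 8))).eval s' = b ^ (2 * t) := fun s' h8 h9 => by
    simp only [NExpr.eval, h8, h9, ht]
    rw [← two_mul, hp _ le_rfl]
  set P := partialProduct b t (s.C 5) (s.C 6) with hP
  refine .mono (.seq (c₁ := 40 * (b ^ (2 * t) + 1))
    (c₂ := 5 + 3200 * ((t + 1) ^ 2 * b * (b ^ (2 * t) + 1)))
    (.mono (.loop (N := b ^ (2 * t)) (c := 20) (hG s rfl rfl) (by decide)
      (fun k s' => ∀ g < k, s'.C 7 0 g = 0) (by simp) (fun _ _ _ h => h) ?_) (by omega)) ?_)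
    (by omega)
  · intro g hg s₁ hF₁ hk₁ hI
    refine .setC ?_ (by decide)
    intro l hl
    simp only [NExpr.eval, CExpr.eval, hk₁, Store.setC_C]
    split_ifs with h
    · simp
    · have : l ≠ g := by simpa using h
      exact hI l (by omega)
  intro s₁ hF₁ h₁
  refine .seq (c₁ := 5) (R := fun s' => ∀ g < b ^ (2 * t), s'.C 7 0 g = (P 0).coeff g)
    (.setC ?_ (by decide)) ?_
  · intro g hg
    simp only [NExpr.eval, CExpr.eval, Store.setC_C, hP, partialProduct, Finset.prod_range_zero,
      Polynomial.coeff_one]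
    by_cases h : g = 0
    · simp [h]
    · simp [h, h₁ g hg]
  intro s₂ hF₂ h₂
  have hN₂ : s₂.N 0 = s.N 0 := (hF₂.N 0 rfl).trans (hF₁.N 0 rfl)
  have h8₂ : s₂.N 8 = s.N 8 := (hF₂.N 8 rfl).trans (hF₁.N 8 rfl)
  have h9₂ : s₂.N 9 = s.N 9 := (hF₂.N 9 rfl).trans (hF₁.N 9 rfl)
  have h5₂ : s₂.C 5 = s.C 5 := (hF₂.C 5 rfl).trans (hF₁.C 5 rfl)
  have h6₂ : s₂.C 6 = s.C 6 := (hF₂.C 6 rfl).trans (hF₁.C 6 rfl)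
  have hc : 1 ≤ (t + 1) ^ 2 * (b ^ (2 * t) + 1) :=
    Nat.mul_pos (Nat.pow_pos (Nat.succ_pos _)) (Nat.succ_pos _)
  refine .mono (.loop (N := n) (c := 1600 * ((t + 1) ^ 2 * (b ^ (2 * t) + 1)))
    (by simp [NExpr.eval, hN₂, hn]) (by simp only [NExpr.cost]; omega)
    (fun i s' => ∀ g < b ^ (2 * t), s'.C 7 i g = (P i).coeff g) h₂ (fun _ _ _ h => h) ?_)
    (le_of_eq (by rw [hb]; ring))
  intro i hi s₃ hF₃ hk₃ hI₃
  have h8₃ : s₃.N 8 = s.N 8 := (hF₃.N 8 rfl).trans h8₂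
  have h9₃ : s₃.N 9 = s.N 9 := (hF₃.N 9 rfl).trans h9₂
  have h5₃ : s₃.C 5 = s.C 5 := (hF₃.C 5 rfl).trans h5₂
  have h6₃ : s₃.C 6 = s.C 6 := (hF₃.C 6 rfl).trans h6₂
  have hc2 : 1 ≤ (t + 1) ^ 2 := Nat.pow_pos (Nat.succ_pos _)
  -- the row `i` of `C 7` is complete, the row `i + 1` is complete up to the column `k`
  refine .mono (.imp (.loop (N := b ^ (2 * t)) (c := 800 * (t + 1) ^ 2) (hG s₃ h8₃ h9₃)
    (by simp only [NExpr.cost]; omega)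
    (fun k s' => (∀ g < b ^ (2 * t), s'.C 7 i g = (P i).coeff g) ∧
      ∀ g < k, s'.C 7 (i + 1) g = (P (i + 1)).coeff g) ⟨hI₃, by simp⟩
    (fun _ _ _ h => h) ?_) fun _ _ h => h.2) (le_of_eq (by ring))
  intro g hg s₄ hF₄ hk₄ hI₄
  have h8₄ : s₄.N 8 = s.N 8 := (hF₄.N 8 rfl).trans h8₃
  have h9₄ : s₄.N 9 = s.N 9 := (hF₄.N 9 rfl).trans h9₃
  have h5₄ : s₄.C 5 = s.C 5 := (hF₄.C 5 rfl).trans h5₃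
  have h6₄ : s₄.C 6 = s.C 6 := (hF₄.C 6 rfl).trans h6₃
  have h2₄ : s₄.N 2 0 = i := (congrFun (hF₄.N 2 rfl) 0).trans hk₃
  -- only the entry `(i + 1, g)` of `C 7` changes from here on
  set J : ℂ → Store → Prop := fun z s' => s'.C 7 (i + 1) g = (P i).coeff g + z ∧
    ∀ i' g', (i' = i + 1 ∧ g' = g) ∨ s'.C 7 i' g' = s₄.C 7 i' g' with hJ
  refine .mono (.seq (c₁ := 20) (c₂ := 600 * (t + 1) ^ 2) (R := J 0) (.setC ?_ (by decide)) ?_)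
    (by omega)
  · simp only [hJ, NExpr.eval, CExpr.eval, Store.setC_C, h2₄, hk₄]
    refine ⟨by simpa using hI₄.1 g hg, fun i' g' => ?_⟩
    by_cases h : i' = i + 1 ∧ g' = g
    · exact .inl h
    · exact .inr (by simp [h])
  intro s₅ hF₅ h₅
  have h8₅ : s₅.N 8 = s.N 8 := (hF₅.N 8 rfl).trans h8₄
  refine .mono (.imp (.loop (N := t) (c := 200 * (t + 1)) (by simp [NExpr.eval, h8₅, ht])
    (by simp only [NExpr.cost]; omega)
    (fun k s' => J (∑ x ∈ Finset.range k, ∑ y ∈ Finset.range t,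
      productTerm b t (s.C 5) (s.C 6) (P i) i g x y) s') (by simpa using h₅)
    (fun _ _ _ h => h) ?_) ?_) (by
      rw [show 2 * (200 * (t + 1)) * (t + 1) = 400 * (t + 1) ^ 2 by ring]; omega)
  · intro x hx s₆ hF₆ hk₆ hI₆
    have h8₆ : s₆.N 8 = s.N 8 := (hF₆.N 8 rfl).trans h8₅
    refine .mono (.imp (.loop (N := t) (c := 100) (by simp [NExpr.eval, h8₆, ht]) (by decide)
      (fun k s' => J (∑ x ∈ Finset.range x, ∑ y ∈ Finset.range t,
        productTerm b t (s.C 5) (s.C 6) (P i) i g x y + ∑ y ∈ Finset.range k,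
        productTerm b t (s.C 5) (s.C 6) (P i) i g x y) s') (by simpa using hI₆)
      (fun _ _ _ h => h) ?_) fun s' _ h => by rwa [Finset.sum_range_succ]) (by omega)
    intro y hy s₇ hF₇ hk₇ hI₇
    have h8₇ : s₇.N 8 = s.N 8 := (hF₇.N 8 rfl).trans h8₆
    have h9₇ : s₇.N 9 = s.N 9 := (hF₇.N 9 rfl).trans
      ((hF₆.N 9 rfl).trans ((hF₅.N 9 rfl).trans h9₄))
    have h3₇ : s₇.N 3 0 = x := (congrFun (hF₇.N 3 rfl) 0).trans hk₆
    refine .mono (.seq (c₁ := 20) (c₂ := 60) (R := fun s' => s'.N 12 0 = b ^ x + b ^ (t + y))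
      (.setN ?_ (by decide)) ?_) (by omega)
    · simp only [NExpr.eval, h8₇, h9₇, h3₇, hk₇, ht, Store.setN_N_self]
      rw [hp x (by omega), hp (t + y) (by omega)]
    intro s₈ hF₈ h12
    have n11 : s₈.N 11 0 = g := (congrFun ((hF₈.N 11 rfl).trans ((hF₇.N 11 rfl).trans
      ((hF₆.N 11 rfl).trans (hF₅.N 11 rfl)))) 0).trans hk₄
    have n2 : s₈.N 2 0 = i := (congrFun ((hF₈.N 2 rfl).trans ((hF₇.N 2 rfl).trans
      ((hF₆.N 2 rfl).trans (hF₅.N 2 rfl)))) 0).trans h2₄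
    have n3 : s₈.N 3 0 = x := (congrFun (hF₈.N 3 rfl) 0).trans h3₇
    have n4 : s₈.N 4 0 = y := (congrFun (hF₈.N 4 rfl) 0).trans hk₇
    have c5 : s₈.C 5 = s.C 5 := (hF₈.C 5 rfl).trans ((hF₇.C 5 rfl).trans
      ((hF₆.C 5 rfl).trans ((hF₅.C 5 rfl).trans h5₄)))
    have c6 : s₈.C 6 = s.C 6 := (hF₈.C 6 rfl).trans ((hF₇.C 6 rfl).trans
      ((hF₆.C 6 rfl).trans ((hF₅.C 6 rfl).trans h6₄)))
    have c7 : s₈.C 7 = s₇.C 7 := hF₈.C 7 rfl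
    refine .mono (.ite (c := 50) (fun hlt => ?_) fun hlt => ?_) (by decide)
    · simp only [Test.holds, NExpr.eval, n11, h12] at hlt
      refine .mono (.skip ?_) (by omega)
      simp only [hJ, c7]
      refine ⟨?_, hI₇.2⟩
      rw [hI₇.1, Finset.sum_range_succ, productTerm, if_pos hlt, add_zero]
    · simp only [Test.holds, NExpr.eval, n11, h12] at hlt
      have hrow : s₇.C 7 i (g - (b ^ x + b ^ (t + y))) =
          (P i).coeff (g - (b ^ x + b ^ (t + y))) := by
        rw [(hI₇.2 _ _).resolve_left (by omega)]
        exact hI₄.1 _ (by omega)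
      refine .setC ?_ (by decide)
      simp only [hJ, NExpr.eval, CExpr.eval, Store.setC_C, n11, n2, n3, n4, h12, c5, c6, c7, hrow]
      refine ⟨?_, fun i' g' => ?_⟩
      · rw [if_pos (by simp), hI₇.1, Finset.sum_range_succ, productTerm, if_neg hlt]
        ring
      · by_cases h : i' = i + 1 ∧ g' = g
        · exact .inl h
        · exact .inr (by simpa [h] using (hI₇.2 i' g').resolve_left h)
  · intro s' _ h
    refine ⟨fun g' hg' => ?_, fun g' hg' => ?_⟩
    · rw [(h.2 i g').resolve_left (by omega)]; exact hI₄.1 g' hg'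
    · rcases Nat.lt_succ_iff_lt_or_eq.1 hg' with hlt | rfl
      · rw [(h.2 (i + 1) g').resolve_left (by omega)]; exact hI₄.2 g' hlt
      · rw [h.1, coeff_partialProduct_succ]

end CRam

/-! ### Programs: factorial weights, contraction, and a value of the generating function -/

namespace CRam

open NExpr (var)
open BosonSampling

/-- Writes the factorials up to `n` to `C 8` and the weights `digitWeight (n + 1) x` to `C 9`. The
weight of `d + (n + 1) g` is `d!` times the weight of `g`, which is computed before it. -/
def weightProg : Prog :=
  .setC 8 (.lit 0) (.lit 0) (.lit 1) ;;
  .loop 2 (var 0) (.setC 8 (.add (var 2) (.lit 1)) (.lit 0)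
    (.mul (.get 8 (var 2) (.lit 0)) (.ofNat (.add (var 2) (.lit 1))))) ;;
  .setC 9 (.lit 0) (.lit 0) (.lit 1) ;;
  .setN 12 (.lit 0) (.lit 0) ;;
  .loop 11 (.get 9 (var 8)) (.loop 2 (.add (var 0) (.lit 1)) (
    .setC 9 (var 12) (.lit 0) (.mul (.get 9 (var 11) (.lit 0)) (.get 8 (var 2) (.lit 0))) ;;
    .setN 12 (.lit 0) (.add (var 12) (.lit 1))))

theorem weightProg_spec {s : Store} {n t b : ℕ} (hn1 : 1 ≤ n) (hb : b = n + 1)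
    (hn : s.N 0 0 = n) (ht : s.N 8 0 = t) (hp : s.N 9 t = b ^ t) :
    Ensures weightProg s (1000 * (b * (b ^ t + 1))) fun s' =>
      ∀ x < b ^ t, s'.C 9 x 0 = (digitWeight b x : ℂ) := by
  unfold weightProg
  have hc : b ≤ b * (b ^ t + 1) := Nat.le_mul_of_pos_right _ (Nat.succ_pos _)
  have hpos : 1 ≤ b ^ t := Nat.pow_pos (by omega)
  refine .mono (.seq (c₁ := 10) (c₂ := 80 * (n + 1) + (10 + (10 + 500 * (b * (b ^ t + 1)))))
    (R := fun s' => s'.C 8 0 0 = 1)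
    (.setC (by simp [NExpr.eval, CExpr.eval, Store.setC_C]) (by decide)) ?_) (by omega)
  intro s₁ hF₁ h₁
  refine .seq (R := fun s' => ∀ d ≤ n, s'.C 8 d 0 = (d.factorial : ℂ))
    (.mono (.loop (N := n) (c := 40) ?_ (by decide)
      (fun k s' => ∀ d ≤ k, s'.C 8 d 0 = (d.factorial : ℂ)) (by simpa using h₁)
      (fun _ _ _ h => h) ?_) (by omega)) ?_
  · rw [← hn]; exact congrFun (hF₁.N 0 rfl) 0
  · intro k hk s₂ hF₂ hk₂ hI
    refine .setC ?_ (by decide)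
    intro d hd
    simp only [NExpr.eval, CExpr.eval, hk₂, Store.setC_C]
    rcases Nat.lt_or_ge k d with hlt | hle
    · obtain rfl : d = k + 1 := by omega
      rw [if_pos (by simp), hI k le_rfl, Nat.factorial_succ]
      push_cast
      ring
    · have : d ≠ k + 1 := by omega
      simp [this, hI d hle]
  intro s₂ hF₂ h₂
  refine .seq (c₁ := 10) (R := fun s' => s'.C 9 0 0 = 1)
    (.setC (by simp [NExpr.eval, CExpr.eval, Store.setC_C]) (by decide)) ?_
  intro s₃ hF₃ h₃
  refine .seq (c₁ := 10) (R := fun s' => s'.N 12 0 = 0 ∧ s'.C 9 0 0 = 1)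
    (.setN ⟨by simp [NExpr.eval], h₃⟩ (by decide)) ?_
  intro s₄ hF₄ h₄
  have hN₄ : s₄.N 0 = s.N 0 := (hF₄.N 0 rfl).trans
    ((hF₃.N 0 rfl).trans ((hF₂.N 0 rfl).trans (hF₁.N 0 rfl)))
  have h8₄ : s₄.N 8 = s.N 8 := (hF₄.N 8 rfl).trans
    ((hF₃.N 8 rfl).trans ((hF₂.N 8 rfl).trans (hF₁.N 8 rfl)))
  have h9₄ : s₄.N 9 = s.N 9 := (hF₄.N 9 rfl).trans
    ((hF₃.N 9 rfl).trans ((hF₂.N 9 rfl).trans (hF₁.N 9 rfl)))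
  have c8₄ : s₄.C 8 = s₂.C 8 := (hF₄.C 8 rfl).trans (hF₃.C 8 rfl)
  refine .mono (.imp (.loop (N := b ^ t) (c := 80 * (b + 1)) ?_
    (by simp only [NExpr.cost]; omega)
    (fun k s' => s'.N 12 0 = k * b ∧ ∀ x, x = 0 ∨ x < k * b → s'.C 9 x 0 = (digitWeight b x : ℂ))
    ⟨by simpa using h₄.1, by simpa using h₄.2⟩ ?_ ?_) ?_) ?_
  · simp only [NExpr.eval, h8₄, h9₄, ht, hp]
  · intro k s' v h
    rwa [Store.setN_N_of_ne _ (by decide)]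
  · intro g hg s₅ hF₅ hk₅ hI₅
    have hN₅ : s₅.N 0 = s.N 0 := (hF₅.N 0 rfl).trans hN₄
    have c8₅ : s₅.C 8 = s₂.C 8 := (hF₅.C 8 rfl).trans c8₄
    refine .mono (.imp (.loop (N := b) (c := 40) (by simp [NExpr.eval, hN₅, hn, hb]) (by decide)
      (fun k s' => s'.N 12 0 = g * b + k ∧
        ∀ x, x = 0 ∨ x < g * b + k → s'.C 9 x 0 = (digitWeight b x : ℂ))
      (by simpa using hI₅) ?_ ?_) ?_) (le_of_eq (by ring))
    · intro k s' v h
      rwa [Store.setN_N_of_ne _ (by decide)]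
    · intro d hd s₆ hF₆ hk₆ hI₆
      -- the weight of `g` has been written already, except that it is the initial one if `g = 0`
      have c8 : s₆.C 8 d 0 = (d.factorial : ℂ) := by
        rw [hF₆.C 8 rfl, c8₅]; exact h₂ d (by omega)
      have n11 : s₆.N 11 0 = g := (congrFun (hF₆.N 11 rfl) 0).trans hk₅
      have hgx : g = 0 ∨ g < g * b + d := by
        rcases Nat.eq_zero_or_pos g with h | h
        · exact .inl h
        · refine .inr (Nat.lt_add_right _ ?_)
          exact (Nat.lt_mul_iff_one_lt_right h).2 (by omega)
      refine .mono (.seq (c₁ := 20) (c₂ := 10) (R := fun s' => s'.N 12 0 = g * b + d ∧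
        ∀ x, x = 0 ∨ x < g * b + d + 1 → s'.C 9 x 0 = (digitWeight b x : ℂ))
        (.setC ⟨hI₆.1, ?_⟩ (by decide)) ?_) (by omega)
      · intro x hx
        simp only [NExpr.eval, CExpr.eval, Store.setC_C, hI₆.1, n11, hk₆, c8, hI₆.2 g hgx]
        by_cases h : x = g * b + d
        · rw [if_pos (by simp [h]), h, add_comm (g * b), mul_comm g b,
            digitWeight_add_mul (by omega) (by omega)]
          push_cast
          ring
        · rw [if_neg (by simp [h])]
          exact hI₆.2 x (by omega)
      · intro s₇ hF₇ h₇
        refine .setN ?_ (by decide)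
        simp only [NExpr.eval, Store.setN_N_self, h₇.1]
        exact ⟨by ring, fun x hx => h₇.2 x (by omega)⟩
    · intro s' _ h
      rwa [Nat.succ_mul]
  · intro s' _ h x hx
    exact h.2 x (.inr (hx.trans_le (Nat.le_mul_of_pos_right _ (by omega))))
  · nlinarith [Nat.zero_le ((b - 1) * (b ^ t + 1)), hc]

/-- Applies `diagSum` to the polynomial in the row `n` of `C 7`. -/
def contractProg : Prog :=
  .setC 10 (.lit 0) (.lit 0) (.lit 0) ;;
  .setN 12 (.lit 0) (.lit 0) ;;
  .loop 11 (.get 9 (var 8)) (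
    .setC 10 (.lit 0) (.lit 0) (.add (.get 10 (.lit 0) (.lit 0))
      (.mul (.get 9 (var 11) (.lit 0)) (.get 7 (var 0) (var 12)))) ;;
    .setN 12 (.lit 0) (.add (var 12) (.add (.lit 1) (.get 9 (var 8)))))

theorem contractProg_spec {s : Store} {n t b : ℕ} (hn : s.N 0 0 = n) (ht : s.N 8 0 = t)
    (hp : s.N 9 t = b ^ t) (f : Polynomial ℂ) (hf : ∀ g < b ^ (2 * t), s.C 7 n g = f.coeff g)
    (hw : ∀ x < b ^ t, s.C 9 x 0 = (digitWeight b x : ℂ)) :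
    Ensures contractProg s (200 * (b ^ t + 1)) fun s' => s'.C 10 0 0 = diagSum b t f := by
  unfold contractProg
  refine .mono (.seq (c₁ := 10) (c₂ := 10 + 100 * (b ^ t + 1))
    (R := fun s' => s'.C 10 0 0 = 0)
    (.setC (by simp [NExpr.eval, CExpr.eval, Store.setC_C]) (by decide)) ?_) (by omega)
  intro s₁ hF₁ h₁
  refine .seq (c₁ := 10) (R := fun s' => s'.N 12 0 = 0 ∧ s'.C 10 0 0 = 0)
    (.setN ⟨by simp [NExpr.eval], h₁⟩ (by decide)) ?_
  intro s₂ hF₂ h₂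
  have h8 : s₂.N 8 = s.N 8 := (hF₂.N 8 rfl).trans (hF₁.N 8 rfl)
  have h9 : s₂.N 9 = s.N 9 := (hF₂.N 9 rfl).trans (hF₁.N 9 rfl)
  refine .mono (.imp (.loop (N := b ^ t) (c := 50) ?_ (by decide)
    (fun k s' => s'.N 12 0 = k + b ^ t * k ∧ s'.C 10 0 0 =
      ∑ g ∈ Finset.range k, (digitWeight b g : ℂ) * f.coeff (g + b ^ t * g))
    (by simpa using h₂) ?_ ?_) fun s' _ h => h.2) (by omega)
  · simp only [NExpr.eval, h8, h9, ht, hp]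
  · intro k s' v h
    rwa [Store.setN_N_of_ne _ (by decide)]
  intro g hg s₃ hF₃ hk₃ hI
  have hN : s₃.N 0 = s.N 0 := (hF₃.N 0 rfl).trans ((hF₂.N 0 rfl).trans (hF₁.N 0 rfl))
  have n8 : s₃.N 8 = s.N 8 := (hF₃.N 8 rfl).trans h8
  have n9 : s₃.N 9 = s.N 9 := (hF₃.N 9 rfl).trans h9
  have c9 : s₃.C 9 = s.C 9 := (hF₃.C 9 rfl).trans ((hF₂.C 9 rfl).trans (hF₁.C 9 rfl))
  have c7 : s₃.C 7 = s.C 7 := (hF₃.C 7 rfl).trans ((hF₂.C 7 rfl).trans (hF₁.C 7 rfl))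
  have hlt : g + b ^ t * g < b ^ (2 * t) := by
    have h1 : b ^ t * (g + 1) ≤ b ^ t * b ^ t := Nat.mul_le_mul_left _ hg
    rw [two_mul, pow_add]
    rw [Nat.mul_succ] at h1
    omega
  refine .mono (.seq (c₁ := 20) (c₂ := 30) (R := fun s' => s'.N 12 0 = g + b ^ t * g ∧
    s'.C 10 0 0 = ∑ g ∈ Finset.range (g + 1), (digitWeight b g : ℂ) * f.coeff (g + b ^ t * g))
    (.setC ⟨hI.1, ?_⟩ (by decide)) ?_) (by omega)
  · simp only [NExpr.eval, CExpr.eval, Store.setC_C, hI.1, hI.2, hk₃, hN, hn, c7, c9]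
    rw [if_pos (by simp), hw g hg, hf _ hlt, Finset.sum_range_succ]
  · intro s₄ hF₄ h₄
    refine .setN ⟨?_, h₄.2⟩ (by decide)
    simp only [NExpr.eval, Store.setN_N_self, h₄.1, hF₄.N 8 rfl, hF₄.N 9 rfl, n8, n9, ht, hp]
    ring

theorem partialProduct_eq_kronPoly (b t n : ℕ) (u v : ℕ → ℕ → ℂ) :
    partialProduct b t u v n =
      kronPoly b (ι := Fin n) (fun i (s : Fin t) => u s i) fun i (s : Fin t) => v s i := by
  rw [partialProduct, kronPoly, Finset.prod_range]
  refine Finset.prod_congr rfl fun i _ => ?_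
  rw [Finset.sum_range, Finset.sum_range]

/-- Computes the generating function with the arguments `C 2 z 0` and writes it to `C 10 0 0`. -/
def coreProg : Prog :=
  hadamardProg ;; eliminateProg ;; powerProg (.add (var 8) (var 8)) ;; productProg ;;
    weightProg ;; contractProg

/-- The store holds the data of the experiment `E`, the modes `M` and the arguments `y`, in the
arrays in which `input` provides them. -/
structure Holds {n m K : ℕ} {H : Type*} [NormedAddCommGroup H] [InnerProductSpace ℂ H]
    (E : BosonSampler n m H) (M : Fin K ↪ Fin m) (y : Fin K → ℂ) (s : Store) : Prop where
  photons : s.N 0 0 = n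
  size : s.N 0 2 = K
  modes : ∀ z : Fin K, s.N 1 z = M z
  amps : ∀ l j : Fin m, s.C 0 l j = E.U l j
  gram : ∀ i j : Fin n, s.C 1 i j = E.S i j
  args : ∀ z : Fin K, s.C 2 z 0 = y z

theorem Holds.sum_hadamardTerm {n m K : ℕ} {H : Type*} [NormedAddCommGroup H]
    [InnerProductSpace ℂ H] {E : BosonSampler n m H} {M : Fin K ↪ Fin m} {y : Fin K → ℂ}
    {s : Store} (h : Holds E M y s) (i j : Fin n) :
    ∑ z ∈ Finset.range K, hadamardTerm s i j z = Matrix.hadamard (E.coupling M y) E.S i j := by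
  rw [Finset.sum_range, Matrix.hadamard_apply, BosonSampler.coupling, Matrix.of_apply,
    Finset.sum_mul]
  refine Finset.sum_congr rfl fun z _ => ?_
  have hU : ∀ j : Fin n, s.C 0 (M z) j = E.U (M z) (E.inMode j) := fun j => h.amps _ (E.inMode j)
  rw [hadamardTerm, h.modes, h.args, h.gram, hU, hU]

/-- A bound for the number of steps of `coreProg`, where `T` bounds the rank. -/
def coreCost (n K T : ℕ) : ℕ :=
  20000 * ((K + 1) * (T + 1) ^ 2 * ((n + 1) ^ 3 + (n + 1) ^ (2 * T + 1)))

theorem coreProg_spec {n m K : ℕ} {H : Type*} [NormedAddCommGroup H] [InnerProductSpace ℂ H]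
    {E : BosonSampler n m H} {M : Fin K ↪ Fin m} {y : Fin K → ℂ} {s : Store}
    (h : Holds E M y s) (hn : 1 ≤ n) :
    Ensures coreProg s (coreCost n K (K * E.S.rank)) fun s' =>
      s'.C 10 0 0 = (1 + Matrix.hadamard (E.coupling M y) E.S).permanent := by
  unfold coreProg coreCost
  set T := K * E.S.rank with hT
  set b := n + 1 with hb
  set X := b ^ 3 + b ^ (2 * T + 1) with hX
  have hXb : b ^ 2 ≤ X := (Nat.pow_le_pow_right (by omega) (by omega)).trans (Nat.le_add_right _ _)
  have hXb1 : b ≤ X := (Nat.le_self_pow (by omega) b).trans hXb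
  have hX3 : b ^ 3 ≤ X := Nat.le_add_right _ _
  have hXT : b * (b ^ (2 * T) + 1) ≤ 2 * X := by
    rw [mul_add, mul_one, ← pow_succ']
    omega
  have hK1 : X ≤ (K + 1) * (T + 1) ^ 2 * X :=
    Nat.le_mul_of_pos_left _ (Nat.mul_pos (Nat.succ_pos _) (Nat.pow_pos (Nat.succ_pos _)))
  have hK2 : (K + 1) * X ≤ (K + 1) * (T + 1) ^ 2 * X :=
    Nat.mul_le_mul_right _ (Nat.le_mul_of_pos_right _ (Nat.pow_pos (Nat.succ_pos _)))
  have hK3 : (T + 1) ^ 2 * X ≤ (K + 1) * (T + 1) ^ 2 * X :=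
    Nat.mul_le_mul_right _ (Nat.le_mul_of_pos_left _ (Nat.succ_pos _))
  have hK4 : (T + 1) * X ≤ (T + 1) ^ 2 * X :=
    Nat.mul_le_mul_right _ (Nat.le_self_pow (by omega) _)
  set Y := (K + 1) * (T + 1) ^ 2 * X with hY
  refine .mono (.seq (c₁ := 360 * Y) (c₂ := 12000 * Y) (.mono (hadamardProg_spec h.photons h.size)
    ?_) ?_) (by omega)
  · refine Nat.mul_le_mul_left _ (le_trans (Nat.mul_le_mul_left _ hXb) hK2)
  intro s₁ hF₁ h₁
  have hN₁ : s₁.N 0 = s.N 0 := hF₁.N 0 rfl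
  have hB : blockMatrix n s₁ = Matrix.hadamard (E.coupling M y) E.S := by
    ext i j
    rw [← h.sum_hadamardTerm, ← h₁ i i.2 j j.2, blockMatrix, Matrix.of_apply]
  refine .mono (.seq (c₁ := 1000 * Y) (c₂ := 11000 * Y)
    (.mono (eliminateProg_spec (by rw [hN₁, h.photons])) ?_) ?_) (by omega)
  · exact Nat.mul_le_mul_left _ (hX3.trans hK1)
  intro s₂ hF₂ h₂
  have hN₂ : s₂.N 0 0 = n := (congrFun ((hF₂.N 0 rfl).trans hN₁) 0).trans h.photons
  set t := s₂.N 8 0 with ht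
  obtain ⟨hrank, hdec⟩ := h₂
  have htT : t ≤ T := by
    rw [hB] at hrank
    exact hrank.trans (E.rank_coupling_hadamard_le M y)
  have hbt : b ^ (2 * t) ≤ b ^ (2 * T) := Nat.pow_le_pow_right (by omega) (by omega)
  have hbt' : b ^ t ≤ b ^ (2 * t) := Nat.pow_le_pow_right (by omega) (by omega)
  have hXt : b * (b ^ (2 * t) + 1) ≤ 2 * X := (Nat.mul_le_mul_left _ (by omega)).trans hXT
  refine .mono (.seq (c₁ := 500 * Y) (c₂ := 10500 * Y) (.mono (powerProg_spec (N := 2 * t) hN₂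
    (fun s' hF => ?_) (by decide)) ?_) ?_) (by omega)
  · simp only [NExpr.eval, hF.N 8 rfl, two_mul, ht]
  · have h1 : (2 * t + 1) * (n + 1) ≤ 2 * ((T + 1) * X) := by
      rw [← mul_assoc]
      exact Nat.mul_le_mul (by omega) hXb1
    omega
  intro s₃ hF₃ h₃
  have hN₃ : s₃.N 0 0 = n := (congrFun (hF₃.N 0 rfl) 0).trans hN₂
  have h8₃ : s₃.N 8 0 = t := congrFun (hF₃.N 8 rfl) 0
  refine .mono (.seq (c₁ := 8000 * Y) (c₂ := 2500 * Y) (.mono (productProg_spec hb hN₃ h8₃ h₃)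
    ?_) ?_) (by omega)
  · have h1 : (t + 1) ^ 2 * b * (b ^ (2 * t) + 1) ≤ 2 * ((T + 1) ^ 2 * X) := by
      calc (t + 1) ^ 2 * b * (b ^ (2 * t) + 1) = (t + 1) ^ 2 * (b * (b ^ (2 * t) + 1)) :=
            mul_assoc _ _ _
        _ ≤ (T + 1) ^ 2 * (2 * X) :=
            Nat.mul_le_mul (Nat.pow_le_pow_left (by omega) _) hXt
        _ = 2 * ((T + 1) ^ 2 * X) := by ring
    omega
  intro s₄ hF₄ h₄
  have hN₄ : s₄.N 0 0 = n := (congrFun (hF₄.N 0 rfl) 0).trans hN₃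
  have h8₄ : s₄.N 8 0 = t := (congrFun (hF₄.N 8 rfl) 0).trans h8₃
  have h9₄ : s₄.N 9 t = b ^ t := (congrFun (hF₄.N 9 rfl) t).trans (h₃ t (by omega))
  have hXt' : b * (b ^ t + 1) ≤ 2 * X := (Nat.mul_le_mul_left _ (by omega)).trans hXt
  refine .mono (.seq (c₁ := 2000 * Y) (c₂ := 400 * Y) (.mono (weightProg_spec hn hb hN₄ h8₄ h9₄)
    (by omega)) ?_) (by omega)
  intro s₅ hF₅ h₅
  have hN₅ : s₅.N 0 0 = n := (congrFun (hF₅.N 0 rfl) 0).trans hN₄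
  have h8₅ : s₅.N 8 0 = t := (congrFun (hF₅.N 8 rfl) 0).trans h8₄
  have h9₅ : s₅.N 9 t = b ^ t := (congrFun (hF₅.N 9 rfl) t).trans h9₄
  have hXt'' : b ^ t + 1 ≤ 2 * X := (Nat.le_mul_of_pos_left _ (by omega)).trans hXt'
  refine .mono (.imp (contractProg_spec hN₅ h8₅ h9₅
    (partialProduct b t (s₃.C 5) (s₃.C 6) n) (fun g hg => ?_) h₅) ?_) (by omega)
  · rw [hF₅.C 7 rfl]; exact h₄ g hg
  · intro s₆ _ h₆
    rw [h₆, partialProduct_eq_kronPoly, ← permanent_one_add_lowRank (by omega)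
      (by rw [Fintype.card_fin]; omega), ← hB]
    congr 2
    ext i j
    rw [Matrix.of_apply, blockMatrix, Matrix.of_apply, hdec i i.2 j j.2, Finset.sum_range,
      hF₃.C 5 rfl, hF₃.C 6 rfl]

end CRam

/-! ### Programs: interpolation and the marginal distribution -/

namespace BosonSampling

/-- The partial product over the nodes `0, …, k - 1` of the Lagrange basis polynomial of the node
`a`. -/
noncomputable def lagrangePartial (a k : ℕ) : Polynomial ℂ :=
  ∏ c ∈ Finset.range k, if c = a then 1 else
    Polynomial.C (((a : ℂ) - c)⁻¹) * (Polynomial.X - Polynomial.C (c : ℂ))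

theorem lagrangePartial_eq_basis {a N : ℕ} (ha : a < N) :
    lagrangePartial a N = Lagrange.basis (Finset.range N) (fun i : ℕ => (i : ℂ)) a := by
  rw [lagrangePartial, Lagrange.basis, ← Finset.mul_prod_erase _ _ (Finset.mem_range.2 ha),
    if_pos rfl, one_mul]
  refine Finset.prod_congr rfl fun c hc => ?_
  rw [if_neg (Finset.ne_of_mem_erase hc), Lagrange.basisDivisor]

theorem coeff_eq_sum_lagrangePartial {N : ℕ} {f : Polynomial ℂ} (hf : f.degree < N) (g : ℕ) :
    f.coeff g = ∑ a ∈ Finset.range N, f.eval (a : ℂ) * (lagrangePartial a N).coeff g := by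
  have h := Lagrange.eq_interpolate (s := Finset.range N) (v := fun i : ℕ => (i : ℂ))
    (f := f) (Nat.cast_injective.injOn) (by simpa using hf)
  conv_lhs => rw [h]
  rw [Lagrange.interpolate_apply, Polynomial.finsetSum_coeff]
  refine Finset.sum_congr rfl fun a ha => ?_
  rw [Polynomial.coeff_C_mul, lagrangePartial_eq_basis (Finset.mem_range.1 ha)]

theorem coeff_lagrangePartial_succ (a k g : ℕ) :
    (lagrangePartial a (k + 1)).coeff g = if k = a then (lagrangePartial a k).coeff g else
      ((if 0 < g then (lagrangePartial a k).coeff (g - 1) else 0) -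
        k * (lagrangePartial a k).coeff g) / ((a : ℂ) - k) := by
  conv_lhs => rw [lagrangePartial, Finset.prod_range_succ, ← lagrangePartial]
  split_ifs with h1 h2
  · rw [mul_one]
  · obtain ⟨g, rfl⟩ : ∃ g', g = g' + 1 := ⟨g - 1, by omega⟩
    rw [mul_left_comm, Polynomial.coeff_C_mul, mul_sub, Polynomial.coeff_sub,
      Polynomial.coeff_mul_X, Polynomial.coeff_mul_C, Nat.add_sub_cancel]
    ring
  · obtain rfl : g = 0 := by omega
    rw [mul_left_comm, Polynomial.coeff_C_mul, mul_sub, Polynomial.coeff_sub,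
      Polynomial.coeff_mul_X_zero, Polynomial.coeff_mul_C]
    ring

end BosonSampling

namespace CRam

open NExpr (var)
open BosonSampling

/-- Sets the arguments `C 2 z 0` of the generating function to `a ^ ((n + 1) ^ z)`, where `a` is
in `N 13 0`. -/
def argsProg : Prog :=
  .setC 2 (.lit 0) (.lit 0) (.ofNat (var 13)) ;;
  .loop 15 (.get 0 (.lit 2)) (
    .setC 12 (.lit 0) (.lit 0) (.lit 1) ;;
    .loop 2 (.add (var 0) (.lit 1)) (.setC 12 (.lit 0) (.lit 0)
      (.mul (.get 12 (.lit 0) (.lit 0)) (.get 2 (var 15) (.lit 0)))) ;;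
    .setC 2 (.add (var 15) (.lit 1)) (.lit 0) (.get 12 (.lit 0) (.lit 0)))

theorem argsProg_spec {s : Store} {n K a : ℕ} (hn : s.N 0 0 = n) (hK : s.N 0 2 = K)
    (ha : s.N 13 0 = a) :
    Ensures argsProg s (500 * ((K + 1) * (n + 1))) fun s' =>
      ∀ z ≤ K, s'.C 2 z 0 = (a : ℂ) ^ (n + 1) ^ z := by
  unfold argsProg
  have hpos : 1 ≤ (K + 1) * (n + 1) := Nat.mul_pos (Nat.succ_pos _) (Nat.succ_pos _)
  refine .mono (.seq (c₁ := 20) (c₂ := 400 * ((K + 1) * (n + 1))) (R := fun s' => s'.C 2 0 0 = a)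
    (.setC (by simp [NExpr.eval, CExpr.eval, Store.setC_C, ha]) (by decide)) ?_) (by omega)
  intro s₁ hF₁ h₁
  have hN₁ : s₁.N 0 = s.N 0 := hF₁.N 0 rfl
  refine .mono (.loop (N := K) (c := 200 * (n + 1)) (by simp [NExpr.eval, hN₁, hK])
    (by simp only [NExpr.cost]; omega)
    (fun k s' => ∀ z ≤ k, s'.C 2 z 0 = (a : ℂ) ^ (n + 1) ^ z) (by simpa using h₁)
    (fun _ _ _ h => h) ?_) (le_of_eq (by ring))
  intro k hk s₂ hF₂ hk₂ hI
  have hN₂ : s₂.N 0 = s.N 0 := (hF₂.N 0 rfl).trans hN₁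
  refine .mono (.seq (c₁ := 10) (c₂ := 40 * (n + 1 + 1) + 20) (R := fun s' => s'.C 12 0 0 = 1)
    (.setC (by simp [NExpr.eval, CExpr.eval, Store.setC_C]) (by decide)) ?_) (by omega)
  intro s₃ hF₃ h₃
  have hN₃ : s₃.N 0 = s.N 0 := (hF₃.N 0 rfl).trans hN₂
  have h15 : s₃.N 15 0 = k := (congrFun (hF₃.N 15 rfl) 0).trans hk₂
  have c2 : s₃.C 2 = s₂.C 2 := hF₃.C 2 rfl
  refine .seq (.mono (.loop (N := n + 1) (c := 20) (by simp [NExpr.eval, hN₃, hn]) (by decide)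
    (fun j s' => s'.C 12 0 0 = ((a : ℂ) ^ (n + 1) ^ k) ^ j) (by simpa using h₃)
    (fun _ _ _ h => h) ?_) (by omega)) ?_
  · intro j hj s₄ hF₄ hk₄ hI₄
    refine .setC ?_ (by decide)
    simp only [NExpr.eval, CExpr.eval, Store.setC_C, hF₄.N 15 rfl, hF₄.C 2 rfl, h15, c2, hI₄,
      hI k le_rfl]
    rw [if_pos (by simp), pow_succ]
  · intro s₄ hF₄ h₄
    refine .setC ?_ (by decide)
    intro z hz
    simp only [NExpr.eval, CExpr.eval, Store.setC_C, hF₄.N 15 rfl, h15, h₄]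
    rcases Nat.lt_or_ge k z with hlt | hle
    · obtain rfl : z = k + 1 := by omega
      rw [if_pos (by simp), ← pow_mul, ← pow_succ]
    · have : z ≠ k + 1 := by omega
      simp [this, hF₄.C 2 rfl, c2, hI z hle]

/-- Writes the coefficients of the partial products of the Lagrange basis polynomial of the node
`N 13 0` for the nodes `0, …, N 14 0 - 1` to the rows of `C 11`. -/
def lagrangeProg : Prog :=
  .loop 11 (var 14) (.setC 11 (.lit 0) (var 11) (.lit 0)) ;;
  .setC 11 (.lit 0) (.lit 0) (.lit 1) ;;
  .loop 15 (var 14) (.loop 11 (var 14) (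
    .ite (.eq (.ofNat (var 15)) (.ofNat (var 13)))
      (.setC 11 (.add (var 15) (.lit 1)) (var 11) (.get 11 (var 15) (var 11)))
      (.ite (.lt (.lit 0) (var 11))
        (.setC 11 (.add (var 15) (.lit 1)) (var 11)
          (.div (.sub (.get 11 (var 15) (.sub (var 11) (.lit 1)))
            (.mul (.ofNat (var 15)) (.get 11 (var 15) (var 11))))
            (.sub (.ofNat (var 13)) (.ofNat (var 15)))))
        (.setC 11 (.add (var 15) (.lit 1)) (var 11)
          (.div (.sub (.lit 0) (.mul (.ofNat (var 15)) (.get 11 (var 15) (var 11))))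
            (.sub (.ofNat (var 13)) (.ofNat (var 15))))))))

theorem lagrangeProg_spec {s : Store} {N a : ℕ} (hN : s.N 14 0 = N) (ha : s.N 13 0 = a) :
    Ensures lagrangeProg s (1000 * (N + 1) ^ 2) fun s' =>
      ∀ g < N, s'.C 11 N g = (lagrangePartial a N).coeff g := by
  unfold lagrangeProg
  have hpos : N + 1 ≤ (N + 1) ^ 2 := Nat.le_self_pow (by omega) _
  refine .mono (.seq (c₁ := 40 * (N + 1)) (c₂ := 10 + 800 * (N + 1) ^ 2)
    (.mono (.loop (N := N) (c := 20) (by exact hN) (by decide)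
      (fun k s' => ∀ g < k, s'.C 11 0 g = 0) (by simp) (fun _ _ _ h => h) ?_) (by omega)) ?_)
    (by omega)
  · intro g hg s₁ hF₁ hk₁ hI
    refine .setC ?_ (by decide)
    intro l hl
    simp only [NExpr.eval, CExpr.eval, hk₁, Store.setC_C]
    split_ifs with h
    · simp
    · have : l ≠ g := by simpa using h
      exact hI l (by omega)
  intro s₁ hF₁ h₁
  refine .seq (c₁ := 10) (R := fun s' => ∀ g < N, s'.C 11 0 g = (lagrangePartial a 0).coeff g)
    (.setC ?_ (by decide)) ?_
  · intro g hg
    simp only [NExpr.eval, CExpr.eval, Store.setC_C, lagrangePartial, Finset.prod_range_zero,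
      Polynomial.coeff_one]
    by_cases h : g = 0
    · simp [h]
    · simp [h, h₁ g hg]
  intro s₂ hF₂ h₂
  have h14₂ : s₂.N 14 = s.N 14 := (hF₂.N 14 rfl).trans (hF₁.N 14 rfl)
  have h13₂ : s₂.N 13 = s.N 13 := (hF₂.N 13 rfl).trans (hF₁.N 13 rfl)
  refine .mono (.loop (N := N) (c := 400 * (N + 1)) (by simp [NExpr.eval, h14₂, hN])
    (by simp only [NExpr.cost]; omega)
    (fun k s' => ∀ g < N, s'.C 11 k g = (lagrangePartial a k).coeff g) h₂ (fun _ _ _ h => h) ?_)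
    (le_of_eq (by ring))
  intro k hk s₃ hF₃ hk₃ hI₃
  have h14₃ : s₃.N 14 = s.N 14 := (hF₃.N 14 rfl).trans h14₂
  have h13₃ : s₃.N 13 = s.N 13 := (hF₃.N 13 rfl).trans h13₂
  refine .mono (.imp (.loop (N := N) (c := 200) (by simp [NExpr.eval, h14₃, hN]) (by decide)
    (fun l s' => (∀ g < N, s'.C 11 k g = (lagrangePartial a k).coeff g) ∧
      ∀ g < l, s'.C 11 (k + 1) g = (lagrangePartial a (k + 1)).coeff g) ⟨hI₃, by simp⟩
    (fun _ _ _ h => h) ?_) fun _ _ h => h.2) (le_of_eq (by ring))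
  intro g hg s₄ hF₄ hk₄ hI₄
  have n13 : s₄.N 13 0 = a := (congrFun ((hF₄.N 13 rfl).trans h13₃) 0).trans ha
  have n15 : s₄.N 15 0 = k := (congrFun (hF₄.N 15 rfl) 0).trans hk₃
  have upd : ∀ z : ℂ, z = (lagrangePartial a (k + 1)).coeff g →
      (∀ g' < N, (s₄.setC 11 (k + 1) g z).C 11 k g' = (lagrangePartial a k).coeff g') ∧
        ∀ g' < g + 1, (s₄.setC 11 (k + 1) g z).C 11 (k + 1) g' =
          (lagrangePartial a (k + 1)).coeff g' := by
    intro z hz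
    refine ⟨fun g' hg' => ?_, fun g' hg' => ?_⟩
    · simpa [Store.setC_C] using hI₄.1 g' hg'
    · rcases Nat.lt_succ_iff_lt_or_eq.1 hg' with hlt | rfl
      · simpa [Store.setC_C, hlt.ne] using hI₄.2 g' hlt
      · simpa [Store.setC_C] using hz
  refine .mono (.ite (c := 100) (fun ht => .setC ?_ (by decide)) fun ht => ?_) (by decide)
  · simp only [Test.holds, NExpr.eval, CExpr.eval, n13, n15, Nat.cast_inj] at ht
    simp only [NExpr.eval, CExpr.eval, n15, hk₄]
    refine upd _ ?_
    rw [hI₄.1 g hg, coeff_lagrangePartial_succ, if_pos ht]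
  · simp only [Test.holds, NExpr.eval, CExpr.eval, n13, n15, Nat.cast_inj] at ht
    refine .mono (.ite (c := 80) (fun hg0 => .setC ?_ (by decide)) fun hg0 => .setC ?_ (by decide))
      (by decide)
    · simp only [Test.holds, NExpr.eval, hk₄] at hg0
      simp only [NExpr.eval, CExpr.eval, n13, n15, hk₄]
      refine upd _ ?_
      rw [hI₄.1 g hg, hI₄.1 (g - 1) (by omega), coeff_lagrangePartial_succ, if_neg ht, if_pos hg0]
    · simp only [Test.holds, NExpr.eval, hk₄] at hg0
      simp only [NExpr.eval, CExpr.eval, n13, n15, hk₄]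
      refine upd _ ?_
      rw [hI₄.1 g hg, coeff_lagrangePartial_succ, if_neg ht, if_neg hg0, Nat.cast_zero]

/-- Computes a value of the generating function. The case `K = 0` is separate, since the exponent
in the time bound is then `1` and the elimination takes too long. -/
def generatingProg : Prog :=
  .ite (.lt (.get 0 (.lit 2)) (.lit 1)) (.setC 3 (.lit 0) (.lit 0) (.lit 1))
    (coreProg ;; .setC 3 (.lit 0) (.lit 0) (.get 10 (.lit 0) (.lit 0)))

/-- Computes the marginal distribution: the generating function at `y z = a ^ ((n + 1) ^ z)` is a
polynomial in `a` of degree less than `(n + 1) ^ K` with the probabilities as coefficients, which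
is interpolated at the nodes `a = 0, …, (n + 1) ^ K - 1`. -/
def marginalProg : Prog :=
  powerProg (.get 0 (.lit 2)) ;;
  .setN 14 (.lit 0) (.get 9 (.get 0 (.lit 2))) ;;
  .loop 13 (var 14) (.setC 3 (var 13) (.lit 0) (.lit 0)) ;;
  .loop 13 (var 14) (argsProg ;; coreProg ;; lagrangeProg ;;
    .loop 11 (var 14) (.setC 3 (var 11) (.lit 0) (.add (.get 3 (var 11) (.lit 0))
      (.mul (.get 10 (.lit 0) (.lit 0)) (.get 11 (var 14) (var 11))))))

variable {n m K : ℕ} {H : Type*} [NormedAddCommGroup H] [InnerProductSpace ℂ H]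

theorem holds_input (E : BosonSampler n m H) (M : Fin K ↪ Fin m) (y : Fin K → ℂ) :
    Holds E M y (input E.U E.S M y) where
  photons := by simp [input]
  size := by simp [input]
  modes z := by simp [input]
  amps l j := by simp [input]
  gram i j := by simp [input]
  args z := by simp [input]

theorem generatingProg_spec {E : BosonSampler n m H} {M : Fin K ↪ Fin m} {y : Fin K → ℂ}
    {s : Store} (h : Holds E M y s) (hn : 1 ≤ n) :
    Ensures generatingProg s (100 + if K = 0 then 0 else coreCost n K (K * E.S.rank)) fun s' =>
      s'.C 3 0 0 = (1 + Matrix.hadamard (E.coupling M y) E.S).permanent := by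
  unfold generatingProg
  refine .mono (.ite (c := 50 + if K = 0 then 0 else coreCost n K (K * E.S.rank))
    (fun ht => .setC ?_ ?_) fun ht => ?_) ?_
  · simp only [Test.holds, NExpr.eval, h.size] at ht
    obtain rfl : K = 0 := by omega
    have : E.coupling M y = 0 := by ext; simp [BosonSampler.coupling]
    simp [NExpr.eval, CExpr.eval, Store.setC_C, this]
  · exact le_trans (by decide) (Nat.le_add_right _ _)
  · simp only [Test.holds, NExpr.eval, h.size] at ht
    refine .mono (.seq (c₂ := 50) (coreProg_spec h hn) fun s' _ h' => .setC ?_ (by decide)) ?_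
    · simpa [NExpr.eval, CExpr.eval, Store.setC_C] using h'
    · rw [if_neg (by omega)]; omega
  · simp only [Test.cost, NExpr.cost]; omega

/-- The generating function of the marginal at `y z = a ^ ((n + 1) ^ z)`, as a polynomial in
`a`. -/
noncomputable def marginalPoly (E : BosonSampler n m H) (M : Fin K ↪ Fin m) : Polynomial ℂ :=
  ∑ k : Fin K → Fin (n + 1), Polynomial.C (E.marginal M (fun z => (k z : ℕ)) : ℂ) *
    Polynomial.X ^ ∑ z, (k z : ℕ) * (n + 1) ^ (z : ℕ)

theorem degree_marginalPoly_lt (E : BosonSampler n m H) (M : Fin K ↪ Fin m) :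
    (marginalPoly E M).degree < ((n + 1) ^ K : ℕ) := by
  rw [marginalPoly, ← Polynomial.mem_degreeLT]
  refine Submodule.sum_mem _ fun k _ => ?_
  rw [Polynomial.mem_degreeLT]
  exact (Polynomial.degree_C_mul_X_pow_le _ _).trans_lt
    (Nat.cast_lt.2 (sum_mul_pow_lt (fun z => (k z : ℕ)) fun z => (k z).2))

theorem coeff_marginalPoly (E : BosonSampler n m H) (M : Fin K ↪ Fin m)
    (k : Fin K → Fin (n + 1)) :
    (marginalPoly E M).coeff (∑ z, (k z : ℕ) * (n + 1) ^ (z : ℕ)) =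
      (E.marginal M (fun z => (k z : ℕ)) : ℂ) := by
  rw [marginalPoly, Polynomial.finsetSum_coeff, Finset.sum_eq_single k]
  · simp
  · intro l _ hl
    rw [Polynomial.coeff_C_mul, Polynomial.coeff_X_pow, if_neg, mul_zero]
    intro h
    have := sum_mul_pow_inj (fun z => (k z).2) (fun z => (l z).2) h
    exact hl (funext fun z => Fin.ext (congrFun this z).symm)
  · simp

theorem eval_marginalPoly (E : BosonSampler n m H) (M : Fin K ↪ Fin m) (a : ℂ) :
    (marginalPoly E M).eval a = (1 + Matrix.hadamard
      (E.coupling M fun z => a ^ (n + 1) ^ (z : ℕ)) E.S).permanent := by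
  rw [← E.sum_marginal_eq_permanent, marginalPoly, Polynomial.eval_finsetSum]
  refine Finset.sum_congr rfl fun k _ => ?_
  rw [Polynomial.eval_mul, Polynomial.eval_C, Polynomial.eval_pow, Polynomial.eval_X,
    ← Finset.prod_pow_eq_pow_sum]
  congr 1
  refine Finset.prod_congr rfl fun z _ => ?_
  rw [← pow_mul, mul_comm]

theorem marginalProg_spec {E : BosonSampler n m H} {M : Fin K ↪ Fin m} {y : Fin K → ℂ}
    {s : Store} (h : Holds E M y s) (hn : 1 ≤ n) :
    Ensures marginalProg s (1000 * ((K + 1) * (n + 1)) + 100 * ((n + 1) ^ K + 1) +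
      2 * (500 * ((K + 1) * (n + 1)) + coreCost n K (K * E.S.rank) +
        2000 * ((n + 1) ^ K + 1) ^ 2) * ((n + 1) ^ K + 1)) fun s' =>
      ∀ g < (n + 1) ^ K, s'.C 3 g 0 = (marginalPoly E M).coeff g := by
  unfold marginalProg
  set N := (n + 1) ^ K with hN
  have hpos : 1 ≤ (K + 1) * (n + 1) := Nat.mul_pos (Nat.succ_pos _) (Nat.succ_pos _)
  have hpos' : N + 1 ≤ (N + 1) ^ 2 := Nat.le_self_pow (by omega) _
  refine .mono (.seq (c₁ := 250 * ((K + 1) * (n + 1))) (powerProg_spec (N := K) h.photons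
    (fun s' hF => ?_) (by decide)) ?_) (c := 250 * ((K + 1) * (n + 1)) + (10 + (40 * (N + 1) +
      2 * (500 * ((K + 1) * (n + 1)) + coreCost n K (K * E.S.rank) +
        2000 * (N + 1) ^ 2) * (N + 1)))) (by omega)
  · simp only [NExpr.eval, hF.N 0 rfl, h.size]
  intro s₁ hF₁ h₁
  have hN₁ : s₁.N 0 = s.N 0 := hF₁.N 0 rfl
  refine .seq (c₁ := 10) (R := fun s' => s'.N 14 0 = N) (.setN ?_ (by decide)) ?_
  · simp only [NExpr.eval, Store.setN_N_self, hN₁, h.size, h₁ K le_rfl, hN]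
  intro s₂ hF₂ h₂
  refine .seq (.mono (.loop (N := N) (c := 20) (by exact h₂) (by decide)
    (fun k s' => ∀ g < k, s'.C 3 g 0 = 0) (by simp) (fun _ _ _ h => h) ?_) (by omega)) ?_
  · intro g hg s₃ hF₃ hk₃ hI
    refine .setC ?_ (by decide)
    intro l hl
    simp only [NExpr.eval, CExpr.eval, hk₃, Store.setC_C]
    split_ifs with h
    · simp
    · have : l ≠ g := by simpa using h
      exact hI l (by omega)
  intro s₃ hF₃ h₃
  have h14₃ : s₃.N 14 0 = N := (congrFun (hF₃.N 14 rfl) 0).trans h₂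
  refine .imp (.loop (N := N) (by exact h14₃) (by simp only [NExpr.cost]; omega)
    (fun k s' => ∀ g < N, s'.C 3 g 0 = ∑ a ∈ Finset.range k,
      (marginalPoly E M).eval (a : ℂ) * (lagrangePartial a N).coeff g) (by simpa using h₃)
    (fun _ _ _ h => h) ?_) ?_
  · intro a ha s₄ hF₄ hk₄ hI
    have n0 : s₄.N 0 = s.N 0 := (hF₄.N 0 rfl).trans
      ((hF₃.N 0 rfl).trans ((hF₂.N 0 rfl).trans hN₁))
    have n1 : s₄.N 1 = s.N 1 := (hF₄.N 1 rfl).trans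
      ((hF₃.N 1 rfl).trans ((hF₂.N 1 rfl).trans (hF₁.N 1 rfl)))
    have c0 : s₄.C 0 = s.C 0 := (hF₄.C 0 rfl).trans
      ((hF₃.C 0 rfl).trans ((hF₂.C 0 rfl).trans (hF₁.C 0 rfl)))
    have c1 : s₄.C 1 = s.C 1 := (hF₄.C 1 rfl).trans
      ((hF₃.C 1 rfl).trans ((hF₂.C 1 rfl).trans (hF₁.C 1 rfl)))
    have n14 : s₄.N 14 0 = N := (congrFun (hF₄.N 14 rfl) 0).trans h14₃
    refine .mono (.seq (argsProg_spec (by rw [n0, h.photons]) (by rw [n0, h.size]) hk₄) ?_)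
      (c := 500 * ((K + 1) * (n + 1)) + (coreCost n K (K * E.S.rank) +
        (1000 * (N + 1) ^ 2 + 100 * (N + 1)))) (by omega)
    intro s₅ hF₅ h₅
    have hold : Holds E M (fun z => (a : ℂ) ^ (n + 1) ^ (z : ℕ)) s₅ := by
      refine ⟨?_, ?_, fun z => ?_, fun l j => ?_, fun i j => ?_, fun z => h₅ z z.2.le⟩
      · rw [hF₅.N 0 rfl, n0, h.photons]
      · rw [hF₅.N 0 rfl, n0, h.size]
      · rw [hF₅.N 1 rfl, n1, h.modes]
      · rw [hF₅.C 0 rfl, c0, h.amps]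
      · rw [hF₅.C 1 rfl, c1, h.gram]
    refine .seq (coreProg_spec hold hn) ?_
    intro s₆ hF₆ h₆
    rw [← eval_marginalPoly] at h₆
    refine .seq (lagrangeProg_spec (N := N) (a := a) ?_ ?_) ?_
    · rw [hF₆.N 14 rfl, hF₅.N 14 rfl, n14]
    · rw [hF₆.N 13 rfl, hF₅.N 13 rfl, hk₄]
    intro s₇ hF₇ h₇
    have n14' : s₇.N 14 0 = N := by
      rw [hF₇.N 14 rfl, hF₆.N 14 rfl, hF₅.N 14 rfl, n14]
    have c3 : s₇.C 3 = s₄.C 3 := (hF₇.C 3 rfl).trans ((hF₆.C 3 rfl).trans (hF₅.C 3 rfl))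
    refine .mono (.imp (.loop (N := N) (c := 50) (by exact n14') (by decide)
      (fun k s' => ∀ g < N, s'.C 3 g 0 = (∑ a ∈ Finset.range a,
        (marginalPoly E M).eval (a : ℂ) * (lagrangePartial a N).coeff g) +
          if g < k then (marginalPoly E M).eval (a : ℂ) * (lagrangePartial a N).coeff g else 0)
      (by simpa [c3] using hI) (fun _ _ _ h => h) ?_) ?_) (by omega)
    · intro g hg s₈ hF₈ hk₈ hI₈
      refine .setC ?_ (by decide)
      intro l hl
      have c10 : s₈.C 10 0 0 = (marginalPoly E M).eval (a : ℂ) := by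
        rw [hF₈.C 10 rfl, hF₇.C 10 rfl, h₆]
      have c11 : s₈.C 11 N g = (lagrangePartial a N).coeff g := by
        rw [hF₈.C 11 rfl, h₇ g hg]
      simp only [NExpr.eval, CExpr.eval, Store.setC_C, hk₈, hF₈.N 14 rfl, n14', c10, c11]
      by_cases hlg : l = g
      · subst hlg
        rw [if_pos (by simp), hI₈ l hl]
        simp
      · rw [if_neg (by simp [hlg]), hI₈ l hl]
        congr 1
        exact if_congr (by omega) rfl rfl
    · intro s' _ h' g hg
      rw [h' g hg, if_pos hg, Finset.sum_range_succ]
  · intro s' _ h' g hg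
    rw [h' g hg, ← coeff_eq_sum_lagrangePartial (degree_marginalPoly_lt E M)]

end CRam

/-! ### Running times -/

namespace CRam

theorem succ_pow_le {n : ℕ} (hn : 1 ≤ n) (e : ℕ) : (n + 1) ^ e ≤ 2 ^ e * n ^ e := by
  rw [← mul_pow]
  exact Nat.pow_le_pow_left (by omega) e

theorem coreCost_le (n K T e : ℕ) (h3 : 3 ≤ e) (hT : 2 * T + 1 ≤ e) :
    coreCost n K T ≤ 40000 * ((K + 1) * (T + 1) ^ 2) * (n + 1) ^ e := by
  have h1 : (n + 1) ^ 3 ≤ (n + 1) ^ e := Nat.pow_le_pow_right (by omega) h3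
  have h2 : (n + 1) ^ (2 * T + 1) ≤ (n + 1) ^ e := Nat.pow_le_pow_right (by omega) hT
  calc coreCost n K T ≤ 20000 * ((K + 1) * (T + 1) ^ 2 * ((n + 1) ^ e + (n + 1) ^ e)) :=
        Nat.mul_le_mul_left _ (Nat.mul_le_mul_left _ (Nat.add_le_add h1 h2))
    _ = 40000 * ((K + 1) * (T + 1) ^ 2) * (n + 1) ^ e := by ring

theorem generatingProg_cost_le {n K r : ℕ} (hn : 1 ≤ n) (hr : 1 ≤ r) :
    (100 + if K = 0 then 0 else coreCost n K (K * r)) ≤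
      (100 + 40000 * ((K + 1) * (K * r + 1) ^ 2) * 2 ^ (2 * K * r + 1)) *
        n ^ (2 * K * r + 1) := by
  have hpos : 1 ≤ n ^ (2 * K * r + 1) := Nat.one_le_pow _ _ hn
  rw [add_mul]
  refine Nat.add_le_add (by omega) ?_
  split_ifs with hK
  · exact Nat.zero_le _
  · have h1 : 1 ≤ K * r := Nat.mul_pos (Nat.pos_of_ne_zero hK) hr
    refine (coreCost_le n K (K * r) (2 * K * r + 1) (by rw [mul_assoc]; omega)
      (by rw [mul_assoc])).trans ?_
    rw [mul_assoc _ (2 ^ _)]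
    exact Nat.mul_le_mul_left _ (succ_pow_le hn _)

theorem marginalProg_cost_le {n : ℕ} (hn : 1 ≤ n) (K T : ℕ) :
    1000 * ((K + 1) * (n + 1)) + 100 * ((n + 1) ^ K + 1) +
      2 * (500 * ((K + 1) * (n + 1)) + coreCost n K T +
        2000 * ((n + 1) ^ K + 1) ^ 2) * ((n + 1) ^ K + 1) ≤
      ((1000 * (K + 1) + 200 + 4 * (500 * (K + 1) + 40000 * ((K + 1) * (T + 1) ^ 2) + 8000)) *
        2 ^ (2 * K + 2 * T + 3 + K)) * n ^ (2 * K + 2 * T + 3 + K) := by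
  set e := 2 * K + 2 * T + 3 with he
  set b := n + 1 with hb
  have h1 : b ≤ b ^ e := Nat.le_self_pow (by omega) _
  have h2 : coreCost n K T ≤ 40000 * ((K + 1) * (T + 1) ^ 2) * b ^ e :=
    coreCost_le n K T e (by omega) (by omega)
  have h3 : b ^ K + 1 ≤ 2 * b ^ K := by
    have : 1 ≤ b ^ K := Nat.one_le_pow _ _ (by omega)
    omega
  have h4 : (b ^ K + 1) ^ 2 ≤ 4 * b ^ e := by
    calc (b ^ K + 1) ^ 2 ≤ (2 * b ^ K) ^ 2 := Nat.pow_le_pow_left h3 2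
      _ = 4 * b ^ (2 * K) := by rw [mul_pow, ← pow_mul, mul_comm K]; norm_num
      _ ≤ 4 * b ^ e := Nat.mul_le_mul_left _ (Nat.pow_le_pow_right (by omega) (by omega))
  have h5 : b ^ e ≤ b ^ (e + K) := Nat.pow_le_pow_right (by omega) (by omega)
  have h6 : b ^ K ≤ b ^ (e + K) := Nat.pow_le_pow_right (by omega) (by omega)
  set A := 500 * (K + 1) + 40000 * ((K + 1) * (T + 1) ^ 2) + 8000 with hA
  have h7 : 500 * ((K + 1) * b) + coreCost n K T + 2000 * (b ^ K + 1) ^ 2 ≤ A * b ^ e := by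
    calc _ ≤ 500 * ((K + 1) * b ^ e) + 40000 * ((K + 1) * (T + 1) ^ 2) * b ^ e +
          2000 * (4 * b ^ e) := by gcongr
      _ = A * b ^ e := by rw [hA]; ring
  calc _ ≤ 1000 * ((K + 1) * b ^ (e + K)) + 100 * (2 * b ^ (e + K)) +
        2 * (A * b ^ e) * (2 * b ^ K) := by
        refine Nat.add_le_add (Nat.add_le_add ?_ ?_) (Nat.mul_le_mul (Nat.mul_le_mul_left _ h7) h3)
        · exact Nat.mul_le_mul_left _ (Nat.mul_le_mul_left _ (h1.trans h5))
        · omega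
    _ = (1000 * (K + 1) + 200 + 4 * A) * b ^ (e + K) := by rw [pow_add]; ring
    _ ≤ (1000 * (K + 1) + 200 + 4 * A) * (2 ^ (e + K) * n ^ (e + K)) :=
        Nat.mul_le_mul_left _ (succ_pow_le hn _)
    _ = _ := by ring

end CRam

theorem mainTheorem6 :
    -- each value of the generating function as a permanent, and the rank bound
    (∀ (n m K : ℕ) (H : Type*) [NormedAddCommGroup H] [InnerProductSpace ℂ H]
      (E : BosonSampler n m H) (M : Fin K ↪ Fin m) (η : Fin K → ℝ),
      E.genFun M η = (1 + Matrix.hadamard (E.W M η) E.S).permanent ∧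
      (Matrix.hadamard (E.W M η) E.S).rank ≤ K * E.S.rank) ∧
    -- one algorithm computes each value exactly in time `O(n ^ (2 K r_S + 1))`
    (∃ P : CRam.Prog, ∀ K r : ℕ, ∃ c : ℕ,
      ∀ (n m : ℕ) (H : Type*) [NormedAddCommGroup H] [InnerProductSpace ℂ H]
        (E : BosonSampler n m H) (M : Fin K ↪ Fin m) (η : Fin K → ℝ),
        1 ≤ n → E.S.rank = r →
        (P.run (CRam.input E.U E.S M fun z => Complex.exp (Complex.I * (η z : ℂ)))).1.C 3 0 0
          = E.genFun M η ∧
        (P.run (CRam.input E.U E.S M fun z => Complex.exp (Complex.I * (η z : ℂ)))).2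
          ≤ c * n ^ (2 * K * r + 1)) ∧
    -- one algorithm computes the whole marginal distribution exactly, in time polynomial in `n`
    -- for constant `K` and `r_S`
    (∃ P : CRam.Prog, ∀ K r : ℕ, ∃ c d : ℕ,
      ∀ (n m : ℕ) (H : Type*) [NormedAddCommGroup H] [InnerProductSpace ℂ H]
        (E : BosonSampler n m H) (M : Fin K ↪ Fin m),
        1 ≤ n → E.S.rank = r →
        (∀ k : Fin K → Fin (n + 1),
          (P.run (CRam.input E.U E.S M fun _ => 0)).1.C 3 (∑ z, (k z : ℕ) * (n + 1) ^ (z : ℕ)) 0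
            = (E.marginal M (fun z => (k z : ℕ)) : ℂ)) ∧
        (P.run (CRam.input E.U E.S M fun _ => 0)).2 ≤ c * n ^ d) ∧
    -- indistinguishable photons are the case `r_S = 1`
    (∀ (n m K : ℕ) (H : Type*) [NormedAddCommGroup H] [InnerProductSpace ℂ H]
      (E : BosonSampler n m H) (M : Fin K ↪ Fin m) (η : Fin K → ℝ),
      1 ≤ n → (∀ i j, E.φ i = E.φ j) →
      E.S.rank = 1 ∧ E.genFun M η = (1 + E.W M η).permanent) := by
  refine ⟨fun n m K H _ _ E M η => ⟨E.genFun_eq_permanent M η, ?_⟩,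
    ⟨CRam.generatingProg, fun K r =>
      ⟨100 + 40000 * ((K + 1) * (K * r + 1) ^ 2) * 2 ^ (2 * K * r + 1),
        fun n m H _ _ E M η hn hr => ?_⟩⟩,
    ⟨CRam.marginalProg, fun K r =>
      ⟨(1000 * (K + 1) + 200 +
          4 * (500 * (K + 1) + 40000 * ((K + 1) * (K * r + 1) ^ 2) + 8000)) *
          2 ^ (2 * K + 2 * (K * r) + 3 + K),
        2 * K + 2 * (K * r) + 3 + K, fun n m H _ _ E M hn hr => ?_⟩⟩,
    fun n m K H _ _ E M η hn hφ => ⟨E.rank_S_of_forall_eq hn hφ, ?_⟩⟩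
  · rw [E.W_eq_coupling]
    exact E.rank_coupling_hadamard_le M _
  · have h := CRam.generatingProg_spec (CRam.holds_input E M
      fun z => Complex.exp (Complex.I * (η z : ℂ))) hn
    refine ⟨?_, h.cost.trans ?_⟩
    · rw [E.genFun_eq_permanent, E.W_eq_coupling]
      exact h.post
    · rw [hr]
      exact CRam.generatingProg_cost_le hn (hr ▸ E.rank_S_pos hn)
  · have h := CRam.marginalProg_spec (CRam.holds_input E M fun _ => 0) hn
    refine ⟨fun k => ?_, h.cost.trans ?_⟩
    · rw [h.post _ (BosonSampling.sum_mul_pow_lt (fun z => (k z : ℕ)) fun z => (k z).2),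
        CRam.coeff_marginalPoly]
    · rw [hr]
      exact CRam.marginalProg_cost_le hn K (K * r)
  · rw [E.genFun_eq_permanent]
    congr 2
    ext i j
    rw [Matrix.hadamard_apply, E.S_eq_of_forall_eq hφ, mul_one]
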